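/- Let $R$ be a commutative Noetherian ring, $I$ an ideal of $R$, $M$ a finitely generated $R$-module and $t\ge 1$ an integer. For $i\ge 0$ let $H^i_I(M)=\varinjlim_n \operatorname{Ext}^i_R(R/I^n,M)$ be the $i$-th local cohomology module of $M$ with support in $I$. For an $R$-module $L$ let $\dim L$ denote the Krull dimension of $\operatorname{Supp}_R L$ (with $\dim 0=-\infty$). For an integer $n \geq 0$, call $L$ an $\mathrm{FD}_{\le n}$ module if there is an exact sequence $0\to F\to L\to D\to 0$ of $R$-modules with $F$ finitely generated and $\dim D\le n$; call $L$ minimax if it has a finitely generated submodule $F$ such that $L/F$ is Artinian; and call $L$ $I$-cofinite if $\operatorname{Supp}_R L\subseteq V(I)$ and $\operatorname{Ext}^j_R(R/I,L)$ is finitely generated for every $j\ge 0$. Suppose that $H^i_I(M)$ is an $\mathrm{FD}_{\le 1}$ module for every $i<t$. Then: (i) $H^i_I(M)$ is $I$-cofinite for every $i<t$; (ii) for every submodule $N$ of $H^t_I(M)$ that is $\mathrm{FD}_{\le 0}$ or minimax, the $R$-modules $\operatorname{Hom}_R(R/I,H^t_I(M)/N)$ and $\operatorname{Ext}^1_R(R/I,H^t_I(M)/N)$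 are finitely generated; in particular, the set $\operatorname{Ass}_R(H^t_I(M)/N)$ of associated primes is finite. -/

import Mathlib

universe u

/-- `dim M ≤ n`, where `dim M` is the Krull dimension of the support of `M`. The value `n = ⊥`
plays the role of `-1`: the zero module is the only module of dimension `≤ ⊥`. -/
def IsDLE (R : Type u) [CommRing R] (n : WithBot ℕ∞) (M : Type u) [AddCommGroup M]
    [Module R M] : Prop :=
  Module.supportDim R M ≤ n

/-- `M` is an `FD_{≤ n}` module: there is an exact sequence `0 → F → M → D → 0` with `F` finitely
generated and `dim D ≤ n`. Up to isomorphism, `F` is a submodule of `M` and `D = M / F`. -/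
def IsFDLE (R : Type u) [CommRing R] (n : WithBot ℕ∞) (M : Type u) [AddCommGroup M]
    [Module R M] : Prop :=
  ∃ F : Submodule R M, F.FG ∧ IsDLE R n (M ⧸ F)

/-- `M` is minimax: it has a finitely generated submodule with Artinian quotient. -/
def IsMinimax (R : Type u) [CommRing R] (M : Type u) [AddCommGroup M] [Module R M] : Prop :=
  ∃ F : Submodule R M, F.FG ∧ IsArtinian R (M ⧸ F)

/-- The `R`-module `Ext^i_R(R/I, L)`. -/
abbrev ExtQuot {R : Type u} [CommRing R] (I : Ideal R) (L : Type u) [AddCommGroup L]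
    [Module R L] (i : ℕ) : Type u :=
  CategoryTheory.Abelian.Ext.{u} (ModuleCat.of R (R ⧸ I)) (ModuleCat.of R L) i

/-- `L` is `I`-cofinite: `Supp L ⊆ V(I)` and all `Ext^i_R(R/I, L)` are finitely generated. -/
def IsIdealCofinite {R : Type u} [CommRing R] (I : Ideal R) (L : Type u) [AddCommGroup L]
    [Module R L] : Prop :=
  Module.support R L ⊆ PrimeSpectrum.zeroLocus (I : Set R) ∧
    ∀ i : ℕ, Module.Finite R (ExtQuot I L i)

/-- The local cohomology module `H^i_I(M)`, the direct limit over `n` of `Ext^i_R(R/I^n, M)`. -/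
noncomputable abbrev LocalCoh {R : Type u} [CommRing R] (I : Ideal R) (i : ℕ) (M : Type u)
    [AddCommGroup M] [Module R M] : ModuleCat.{u} R :=
  (localCohomology I i).obj (ModuleCat.of R M)

/-!
# Cofiniteness of local cohomology modules in dimension at most one

Two facts carry the proof. Write `Γ_I` for `I`-power torsion, and call a module torsion when every
element is annihilated by a power of `I`.

*Propagation* (`extFin_extLim_of_forall_lt`). If all `Ext^j(R/I, M)` are finitely generated and the
modules `H^i_I(M)`, `i < t`, have all their `Ext^j(R/I, -)` finitely generated, then
`Hom(R/I, H^t_I(M))` and `Ext^1(R/I, H^t_I(M))` are finitely generated. For `t = 0` this is the long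
exact sequence of `0 → Γ_I(M) → M → M/Γ_I(M) → 0`. For `t > 0` one may divide by `Γ_I(M) = H^0_I(M)`,
which has no local cohomology in positive degrees, embed `M/Γ_I(M)` into a module `E/Γ_I(E)` with `E`
injective, and pass to the cokernel: `E/Γ_I(E)` has no `Ext` from any quotient of any `R/I^n`, so
both `H^i_I(-)` and `Ext^j(R/I, -)` shift by one degree. What makes this work is that `Γ_I(E)` is
again injective (Artin–Rees).

*Small dimension* (`extFin_of_supportDim_lt`). A torsion module `N` with `dim N < k ≤ 2` and
`Ext^j(R/I, N)` finitely generated for `j < k` has all `Ext^j(R/I, N)` finitely generated. At a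
minimal prime `p` of its support `N_p` is Artinian, because its socle is finitely generated, so for
`x ∈ I` the chain `x^n N_p` is stationary; there are finitely many such `p`, so for some `n` the
module `x^n N / x^(n+1) N` has smaller dimension and induction on the dimension applies to it. The
kernels of `x^n` on `N` and of `x` on `x^n N` are treated by induction on the number of generators
of `I` that do not act nilpotently. The bound `k ≤ 2` enters because `Ext^1(R/I, ker φ)` is
controlled by `Hom(R/I, im φ)`, for which only the inclusion of `im φ` in `N` is needed.

For an `FD_{≤ 1}` module the finitely generated submodule is harmless, and strong induction on `i`
gives (i). For (ii), minimax modules are `FD_{≤ 0}`, so `N` has all its `Ext^j(R/I, -)` finitely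
generated, and the long exact sequence for `H^t_I(M)/N` concludes; the associated primes of this
torsion module are those of its submodule `Hom(R/I, H^t_I(M)/N)`.

Mathlib defines local cohomology with the `Ext` obtained by deriving `Hom` in the first variable,
which has no long exact sequence in the second one. It is therefore first compared, naturally in the
first variable, with the `Ext` of the derived category (`leftDerivedExtEquiv`, `localCohEquiv`).
-/

open CategoryTheory Opposite Limits

/-! ### Comparison of the two definitions of `Ext` -/

section OppositeComplex

variable {R : Type u} [Ring R] (K : ChainComplex (ModuleCat.{u} R)ᵒᵖ ℕ)

lemma homologyι_unop_surjective (i : ℕ) : Function.Surjective (K.homologyι i).unop :=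
  (ModuleCat.epi_iff_surjective _).mp inferInstance

lemma pOpcycles_unop_injective (i : ℕ) : Function.Injective (K.pOpcycles i).unop :=
  (ModuleCat.mono_iff_injective _).mp inferInstance

lemma d_unop_pOpcycles_unop (j i : ℕ) (w : (K.opcycles i).unop) :
    (K.d j i).unop ((K.pOpcycles i).unop w) = 0 := by
  have h : (K.pOpcycles i).unop ≫ (K.d j i).unop = 0 := by
    rw [← unop_comp, K.d_pOpcycles, unop_zero]
  exact congr($h w)

/-- Read in the opposite category, the opcycles of `K` are the cocycles of the complex `K.unop`. -/
lemma exists_pOpcycles_unop_eq (i : ℕ) (f : (K.X i).unop)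
    (hf : (K.d (i + 1) i).unop f = 0) : ∃ w, (K.pOpcycles i).unop w = f := by
  have h := (ShortComplex.exact_of_g_is_cokernel (ShortComplex.mk _ _ (K.d_pOpcycles (i + 1) i))
    (K.opcyclesIsCokernel (i + 1) i (by simp))).unop
  exact (ShortComplex.moduleCat_exact_iff _).mp h f hf

/-- A cocycle has zero cohomology class exactly when it is a coboundary. In degree `0` the chosen
`next` index is `0` itself and the differential is zero. -/
lemma homologyι_unop_eq_zero_iff (i : ℕ) (w : (K.opcycles i).unop) :
    (K.homologyι i).unop w = 0 ↔
      ∃ g, (K.d i ((ComplexShape.down ℕ).next i)).unop g = (K.pOpcycles i).unop w := by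
  set j := (ComplexShape.down ℕ).next i
  have hd : (K.d i j).unop = (K.fromOpcycles i j).unop ≫ (K.pOpcycles i).unop := by
    rw [← unop_comp, K.p_fromOpcycles]
  constructor
  · intro hw
    have h := (ShortComplex.exact_of_f_is_kernel
      (ShortComplex.mk _ _ (K.homologyι_comp_fromOpcycles i j))
      (K.homologyIsKernel i j rfl)).unop
    obtain ⟨g, hg⟩ := (ShortComplex.moduleCat_exact_iff _).mp h w hw
    refine ⟨g, ?_⟩
    rw [hd, ← hg]
    rfl
  · rintro ⟨g, hg⟩
    have h : (K.fromOpcycles i j).unop g = w := by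
      apply pOpcycles_unop_injective
      rw [← hg, hd]
      rfl
    have h0 : (K.fromOpcycles i j).unop ≫ (K.homologyι i).unop = 0 := by
      rw [← unop_comp, K.homologyι_comp_fromOpcycles, unop_zero]
    rw [← h]
    exact congr($h0 g)

end OppositeComplex

namespace CategoryTheory.ProjectiveResolution

variable {R : Type u} [CommRing R] {X : ModuleCat.{u} R} (Y : ModuleCat.{u} R)

/-- In degree `0` there are no coboundaries: a cocycle is determined by its class in `Ext^0`. -/
lemma extMk_zero_eq_zero {X Y : ModuleCat.{u} R} (P : ProjectiveResolution X)
    (f : P.complex.X 0 ⟶ Y) (hf : P.complex.d 1 0 ≫ f = 0) :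
    P.extMk f 1 rfl hf = 0 ↔ f = 0 := by
  refine ⟨fun h ↦ ?_, fun h ↦ by subst h; simp⟩
  rw [← P.extEquivCohomologyClass.apply_eq_iff_eq,
    extEquivCohomologyClass_extMk, extEquivCohomologyClass_zero,
    CochainComplex.HomComplex.CohomologyClass.mk_eq_zero_iff,
    CochainComplex.HomComplex.Cocycle.toSingleMk_mem_coboundaries_iff _ _ _ _ _ 1 (by simp)] at h
  obtain ⟨g, hg⟩ := h
  have h1 : P.cochainComplex.d (-(0 : ℕ)) 1 = 0 := by
    apply (P.complex.isZero_extend_X ComplexShape.embeddingDownNat 1 ?_).eq_of_tgt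
    intro i hi
    simp at hi
    omega
  rw [h1, zero_comp] at hg
  rw [← cancel_epi (P.cochainComplexXIso (-(0 : ℕ)) 0 rfl).hom, ← hg, comp_zero]

variable {Y} in
lemma smul_extMk (P : ProjectiveResolution X) {n : ℕ} (r : R) (f : P.complex.X n ⟶ Y)
    (m : ℕ) (hm : n + 1 = m) (hf : P.complex.d m n ≫ f = 0) :
    r • P.extMk f m hm hf = P.extMk (r • f) m hm (by simp [hf]) := by
  rw [Abelian.Ext.smul_eq_comp_mk₀, extMk_comp_mk₀]
  simp

/-- The complex of modules `Hom(P, Y)`, as a chain complex in the opposite category. -/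
noncomputable abbrev homComplex (P : ProjectiveResolution X) :
    ChainComplex (ModuleCat.{u} R)ᵒᵖ ℕ :=
  (((linearYoneda R (ModuleCat.{u} R)).obj Y).rightOp.mapHomologicalComplex _).obj P.complex

/-- The underlying morphism `P_n ⟶ Y` of a cocycle of `Hom(P, Y)`. -/
noncomputable def cocycleHom (P : ProjectiveResolution X) (n : ℕ) :
    ((P.homComplex Y).opcycles n).unop →ₗ[R] (P.complex.X n ⟶ Y) :=
  ((P.homComplex Y).pOpcycles n).unop.hom

lemma d_comp_cocycleHom (P : ProjectiveResolution X) (m n : ℕ)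
    (w : ((P.homComplex Y).opcycles n).unop) :
    P.complex.d m n ≫ P.cocycleHom Y n w = 0 :=
  d_unop_pOpcycles_unop (P.homComplex Y) m n w

/-- The map sending a cocycle of `Hom(P, Y)` to its class in `Ext^n(X, Y)`. -/
noncomputable def cocycleToExt (P : ProjectiveResolution X) (n : ℕ) :
    ((P.homComplex Y).opcycles n).unop →ₗ[R] Abelian.Ext X Y n where
  toFun w := P.extMk (P.cocycleHom Y n w) (n + 1) rfl (P.d_comp_cocycleHom Y _ _ w)
  map_add' a b := by simp [add_extMk]
  map_smul' r a := by simp [smul_extMk]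

lemma cocycleToExt_surjective (P : ProjectiveResolution X) (n : ℕ) :
    Function.Surjective (P.cocycleToExt Y n) := by
  intro ξ
  obtain ⟨f, hf, rfl⟩ := P.extMk_surjective ξ (n + 1) rfl
  obtain ⟨w, hw⟩ := exists_pOpcycles_unop_eq (P.homComplex Y) n f hf
  refine ⟨w, ?_⟩
  have hw' : P.cocycleHom Y n w = f := hw
  simp [cocycleToExt, hw']

lemma cocycleToExt_eq_zero_iff (P : ProjectiveResolution X) (n : ℕ)
    (w : ((P.homComplex Y).opcycles n).unop) :
    P.cocycleToExt Y n w = 0 ↔ ((P.homComplex Y).homologyι n).unop w = 0 := by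
  rw [homologyι_unop_eq_zero_iff]
  cases n with
  | zero =>
    refine (P.extMk_zero_eq_zero (P.cocycleHom Y 0 w) (P.d_comp_cocycleHom Y _ _ w)).trans
      ⟨fun h ↦ ⟨0, ?_⟩, ?_⟩
    · rw [map_zero]; exact h.symm
    · rintro ⟨g, hg⟩
      have h0 : (P.homComplex Y).d 0 ((ComplexShape.down ℕ).next 0) = 0 :=
        HomologicalComplex.shape _ _ _ (by simp)
      rw [h0] at hg
      exact hg.symm
  | succ n =>
    have hn : (ComplexShape.down ℕ).next (n + 1) = n := by simp
    rw [hn]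
    exact P.extMk_eq_zero_iff (P.cocycleHom Y (n + 1) w) (n + 2) rfl
      (P.d_comp_cocycleHom Y _ _ w) n rfl

/-- The comparison of the cohomology of `Hom(P, Y)` with `Ext^n(X, Y)`. -/
noncomputable def homologyEquivExt (P : ProjectiveResolution X) (n : ℕ) :
    ((P.homComplex Y).homology n).unop ≃ₗ[R] Abelian.Ext X Y n :=
  (LinearMap.quotKerEquivOfSurjective ((P.homComplex Y).homologyι n).unop.hom
    (homologyι_unop_surjective _ n)).symm ≪≫ₗ
  Submodule.quotEquivOfEq _ _ (by
    ext w; exact (P.cocycleToExt_eq_zero_iff Y n w).symm) ≪≫ₗ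
  LinearMap.quotKerEquivOfSurjective (P.cocycleToExt Y n) (P.cocycleToExt_surjective Y n)

lemma homologyEquivExt_homologyι (P : ProjectiveResolution X) (n : ℕ)
    (w : ((P.homComplex Y).opcycles n).unop) :
    P.homologyEquivExt Y n (((P.homComplex Y).homologyι n).unop w) = P.cocycleToExt Y n w := by
  have h : (LinearMap.quotKerEquivOfSurjective ((P.homComplex Y).homologyι n).unop.hom
      (homologyι_unop_surjective _ n)).symm (((P.homComplex Y).homologyι n).unop w) =
      Submodule.Quotient.mk w := by
    rw [LinearEquiv.symm_apply_eq]; rfl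
  simp only [homologyEquivExt, LinearEquiv.trans_apply, h]
  rfl

end CategoryTheory.ProjectiveResolution

section Comparison

variable {R : Type u} [CommRing R]

/-- The left derived functor `Ext` agrees with the `Ext` of the derived category. -/
noncomputable def leftDerivedExtEquiv (X Y : ModuleCat.{u} R) (n : ℕ) :
    ((Ext R (ModuleCat.{u} R) n).obj (op X)).obj Y ≃ₗ[R] Abelian.Ext X Y n :=
  ((projectiveResolution X).isoLeftDerivedObj
    ((linearYoneda R (ModuleCat.{u} R)).obj Y).rightOp n).unop.symm.toLinearEquiv ≪≫ₗ
  (projectiveResolution X).homologyEquivExt Y n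

/-- The comparison is natural in the first variable, which is what the transition maps
`Ext^i(R/I^n, M) → Ext^i(R/I^m, M)` require. -/
lemma leftDerivedExtEquiv_naturality {X X' : ModuleCat.{u} R} (Y : ModuleCat.{u} R) (g : X ⟶ X')
    (n : ℕ) (a : ((Ext R (ModuleCat.{u} R) n).obj (op X')).obj Y) :
    leftDerivedExtEquiv X Y n (((Ext R (ModuleCat.{u} R) n).map g.op).app Y a) =
      (Abelian.Ext.mk₀ g).comp (leftDerivedExtEquiv X' Y n a) (zero_add n) := by
  let P := projectiveResolution X
  let P' := projectiveResolution X'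
  let F := ((linearYoneda R (ModuleCat.{u} R)).obj Y).rightOp
  let φ : P.Hom P' g := ⟨ProjectiveResolution.lift g P P',
    ProjectiveResolution.lift_commutes_zero g P P'⟩
  obtain ⟨z, rfl⟩ : ∃ z, (P'.isoLeftDerivedObj F n).hom.unop z = a :=
    (P'.isoLeftDerivedObj F n).unop.toLinearEquiv.surjective a
  obtain ⟨w, rfl⟩ := homologyι_unop_surjective (P'.homComplex Y) n z
  have e1 (Z : ModuleCat.{u} R) (v : (((projectiveResolution Z).homComplex Y).homology n).unop) :
      leftDerivedExtEquiv Z Y n (((projectiveResolution Z).isoLeftDerivedObj F n).hom.unop v) =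
        (projectiveResolution Z).homologyEquivExt Y n v := by
    exact congrArg ((projectiveResolution Z).homologyEquivExt Y n)
      (((projectiveResolution Z).isoLeftDerivedObj F n).unop.toLinearEquiv.symm_apply_apply v)
  have e2 : (P'.isoLeftDerivedObj F n).hom.unop ≫ ((F.leftDerived n).map g).unop =
      (HomologicalComplex.homologyMap ((F.mapHomologicalComplex _).map φ.hom) n).unop ≫
        (P.isoLeftDerivedObj F n).hom.unop :=
    congrArg Quiver.Hom.unop (ProjectiveResolution.isoLeftDerivedObj_hom_naturality g P P' φ.hom
      (ProjectiveResolution.lift_commutes_zero g P P') F n)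
  have e3 : (((Ext R (ModuleCat.{u} R) n).map g.op).app Y)
      ((P'.isoLeftDerivedObj F n).hom.unop (((P'.homComplex Y).homologyι n).unop w)) =
      (P.isoLeftDerivedObj F n).hom.unop
        ((HomologicalComplex.homologyMap ((F.mapHomologicalComplex _).map φ.hom) n).unop
          (((P'.homComplex Y).homologyι n).unop w)) := congr($e2 _)
  have e4 : ((P'.homComplex Y).homologyι n).unop ≫
      (HomologicalComplex.homologyMap ((F.mapHomologicalComplex _).map φ.hom) n).unop =
      (HomologicalComplex.opcyclesMap ((F.mapHomologicalComplex _).map φ.hom) n).unop ≫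
        ((P.homComplex Y).homologyι n).unop := by
    rw [← unop_comp, ← unop_comp, HomologicalComplex.homologyι_naturality]
  have e5 : (HomologicalComplex.homologyMap ((F.mapHomologicalComplex _).map φ.hom) n).unop
          (((P'.homComplex Y).homologyι n).unop w) =
      ((P.homComplex Y).homologyι n).unop
        ((HomologicalComplex.opcyclesMap ((F.mapHomologicalComplex _).map φ.hom) n).unop w) :=
    congr($e4 w)
  have e6 : ((P'.homComplex Y).pOpcycles n).unop ≫ (F.map (φ.hom.f n)).unop =
      (HomologicalComplex.opcyclesMap ((F.mapHomologicalComplex _).map φ.hom) n).unop ≫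
        ((P.homComplex Y).pOpcycles n).unop :=
    congrArg Quiver.Hom.unop
      (HomologicalComplex.p_opcyclesMap ((F.mapHomologicalComplex _).map φ.hom) n).symm
  have e7 : P.cocycleHom Y n
      ((HomologicalComplex.opcyclesMap ((F.mapHomologicalComplex _).map φ.hom) n).unop w) =
      φ.hom.f n ≫ P'.cocycleHom Y n w := congr($(e6.symm) w)
  rw [e3, e5, e1, e1, P.homologyEquivExt_homologyι, P'.homologyEquivExt_homologyι]
  simp only [ProjectiveResolution.cocycleToExt, LinearMap.coe_mk, AddHom.coe_mk]
  rw [ProjectiveResolution.mk₀_comp_extMk (φ := φ)]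
  simp only [e7]

end Comparison

/-! ### Local cohomology as a direct limit -/

section DirectLimit

variable {R : Type u} [CommRing R] (I : Ideal R)

/-- The projection `R/I^m → R/I^n` for `n ≤ m`. -/
noncomputable def powQuotMap {n m : ℕ} (h : n ≤ m) :
    ModuleCat.of R (R ⧸ I ^ m) ⟶ ModuleCat.of R (R ⧸ I ^ n) :=
  ModuleCat.ofHom (Submodule.mapQ _ _ LinearMap.id (Ideal.pow_le_pow_right h))

lemma powQuotMap_refl (n : ℕ) : powQuotMap I (le_refl n) = 𝟙 _ := by
  apply ModuleCat.hom_ext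
  apply LinearMap.ext
  rintro ⟨x⟩
  rfl

lemma powQuotMap_comp {n m k : ℕ} (h : n ≤ m) (h' : m ≤ k) :
    powQuotMap I h' ≫ powQuotMap I h = powQuotMap I (h.trans h') := by
  apply ModuleCat.hom_ext
  apply LinearMap.ext
  rintro ⟨x⟩
  rfl

variable (i : ℕ) (M : Type u) [AddCommGroup M] [Module R M]

/-- The module `Ext^i_R(R/I^n, M)`. -/
abbrev ExtPow (n : ℕ) : Type u :=
  Abelian.Ext.{u} (ModuleCat.of R (R ⧸ I ^ n)) (ModuleCat.of R M) i

/-- The transition map `Ext^i(R/I^n, M) → Ext^i(R/I^m, M)` for `n ≤ m`. -/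
noncomputable abbrev extPowMap (n m : ℕ) (h : n ≤ m) : ExtPow I i M n →ₗ[R] ExtPow I i M m :=
  (Abelian.Ext.mk₀ (powQuotMap I h)).precompOfLinear R (ModuleCat.of R M) (zero_add i)

instance : DirectedSystem (ExtPow I i M) (fun n m h ↦ extPowMap I i M n m h) where
  map_self n x := by simp [powQuotMap_refl]
  map_map n m k h h' x := by
    simp [← powQuotMap_comp I h h']

/-- Local cohomology, as the direct limit of the modules `Ext^i(R/I^n, M)` formed in the derived
category. -/
abbrev ExtLim : Type u := Module.DirectLimit (ExtPow I i M) (extPowMap I i M)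

variable {I i M} in
lemma exists_extPowMap_eq_zero {n : ℕ} {x : ExtPow I i M n}
    (h : Module.DirectLimit.of R ℕ (ExtPow I i M) (extPowMap I i M) n x = 0) :
    ∃ m, ∃ h : n ≤ m, extPowMap I i M n m h x = 0 :=
  Module.DirectLimit.of.zero_exact h

/-- The system whose colimit is `localCohomology I i` evaluated at `M`. -/
noncomputable abbrev locDiagram : ℕᵒᵖᵒᵖ ⥤ ModuleCat.{u} R :=
  localCohomology.diagram (localCohomology.idealPowersDiagram I) i ⋙
    (evaluation _ _).obj (ModuleCat.of R M)

/-- The local cohomology module as a cocone over `locDiagram`. -/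
noncomputable abbrev locCocone : Cocone (locDiagram I i M) :=
  ((evaluation _ _).obj (ModuleCat.of R M)).mapCocone
    (colimit.cocone (localCohomology.diagram (localCohomology.idealPowersDiagram I) i))

/-- Evaluation at `M` preserves colimits, so `locCocone` is a colimit cocone. -/
noncomputable def locCoconeIsColimit : IsColimit (locCocone I i M) :=
  isColimitOfPreserves _ (colimit.isColimit _)

/-- The comparison `Ext^i(R/I^n, M) ≃ Ext^i(R/I^n, M)` of both definitions of `Ext`. -/
noncomputable def extPowEquiv (n : ℕ) :
    (locDiagram I i M).obj (op (op n)) ≃ₗ[R] ExtPow I i M n :=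
  leftDerivedExtEquiv (ModuleCat.of R (R ⧸ I ^ n)) (ModuleCat.of R M) i

lemma extPowEquiv_map {n m : ℕ} (h : n ≤ m) (w : op (op n) ⟶ op (op m))
    (x : (locDiagram I i M).obj (op (op n))) :
    extPowEquiv I i M m ((locDiagram I i M).map w x) =
      extPowMap I i M n m h (extPowEquiv I i M n x) :=
  leftDerivedExtEquiv_naturality (ModuleCat.of R M) (powQuotMap I h) i x

/-- The structure map of the colimit defining local cohomology. -/
noncomputable def locι (n : ℕ) : (locDiagram I i M).obj (op (op n)) →ₗ[R] LocalCoh I i M :=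
  ((locCocone I i M).ι.app (op (op n))).hom

lemma locι_map {n m : ℕ} (w : op (op n) ⟶ op (op m)) (x : (locDiagram I i M).obj (op (op n))) :
    locι I i M m ((locDiagram I i M).map w x) = locι I i M n x :=
  congr($((locCocone I i M).w w) x)

instance : PreservesFilteredColimitsOfSize.{0, 0} (forget (ModuleCat.{u} R)) :=
  preservesFilteredColimitsOfSize_shrink.{0, u, 0, u} _

lemma exists_locι_eq (y : LocalCoh I i M) : ∃ n x, locι I i M n x = y := by
  obtain ⟨k, x, hx⟩ := Concrete.isColimit_exists_rep (locDiagram I i M)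
    (locCoconeIsColimit I i M) y
  exact ⟨k.unop.unop, x, hx⟩

lemma exists_map_eq_zero_of_locι_eq_zero {n : ℕ} {x : (locDiagram I i M).obj (op (op n))}
    (hx : locι I i M n x = 0) :
    ∃ m, ∃ _ : n ≤ m, ∃ w : op (op n) ⟶ op (op m), (locDiagram I i M).map w x = 0 := by
  obtain ⟨k, f, g, hfg⟩ := Concrete.isColimit_exists_of_rep_eq (locDiagram I i M)
    (locCoconeIsColimit I i M) x (0 : (locDiagram I i M).obj (op (op n)))
    (hx.trans (map_zero (locι I i M n)).symm)
  exact ⟨k.unop.unop, leOfHom f.unop.unop, f, hfg.trans (map_zero _)⟩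

/-- The comparison map from `ExtLim I i M` to local cohomology. -/
noncomputable def extLimToLocalCoh : ExtLim I i M →ₗ[R] LocalCoh I i M :=
  Module.DirectLimit.lift R ℕ _ _
    (fun n ↦ locι I i M n ∘ₗ (extPowEquiv I i M n).symm.toLinearMap)
    (fun n m h x ↦ by
      obtain ⟨x, rfl⟩ := (extPowEquiv I i M n).surjective x
      have h1 := extPowEquiv_map I i M h (homOfLE h).op.op x
      have h2 := locι_map I i M (homOfLE h).op.op x
      rw [← h1]
      simpa using! h2)

lemma extLimToLocalCoh_of (n : ℕ) (x : (locDiagram I i M).obj (op (op n))) :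
    extLimToLocalCoh I i M (Module.DirectLimit.of R ℕ _ _ n (extPowEquiv I i M n x)) =
      locι I i M n x := by
  rw [extLimToLocalCoh, Module.DirectLimit.lift_of, LinearMap.comp_apply]
  exact congrArg (locι I i M n) ((extPowEquiv I i M n).symm_apply_apply x)

lemma extLimToLocalCoh_bijective : Function.Bijective (extLimToLocalCoh I i M) := by
  constructor
  · rw [injective_iff_map_eq_zero]
    intro z hz
    obtain ⟨n, x, rfl⟩ := Module.DirectLimit.exists_of z
    obtain ⟨x, rfl⟩ := (extPowEquiv I i M n).surjective x
    rw [extLimToLocalCoh_of] at hz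
    obtain ⟨m, h, w, hw⟩ := exists_map_eq_zero_of_locι_eq_zero I i M hz
    have h1 := extPowEquiv_map I i M h w x
    rw [hw] at h1
    rw [← Module.DirectLimit.of_f (hij := h), ← h1]
    exact (congrArg _ (map_zero (extPowEquiv I i M m))).trans (map_zero _)
  · intro y
    obtain ⟨n, x, rfl⟩ := exists_locι_eq I i M y
    exact ⟨_, extLimToLocalCoh_of I i M n x⟩

/-- Mathlib's local cohomology is the direct limit of the `Ext` modules of the derived
category. -/
noncomputable def localCohEquiv : ExtLim I i M ≃ₗ[R] LocalCoh I i M :=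
  LinearEquiv.ofBijective _ (extLimToLocalCoh_bijective I i M)

end DirectLimit

/-! ### Finiteness of `Ext(R/I, -)` in short exact sequences -/

section FiniteExt

variable {R : Type u} [CommRing R]

lemma LinearMap.exact_subtype_ker_rangeRestrict {A B : Type*} [AddCommGroup A] [AddCommGroup B]
    [Module R A] [Module R B] (f : A →ₗ[R] B) :
    Function.Exact (LinearMap.ker f).subtype f.rangeRestrict := by
  rw [LinearMap.exact_iff, LinearMap.ker_rangeRestrict, Submodule.range_subtype]

lemma Module.Finite.of_exact_of_finite [IsNoetherianRing R] {A B C : Type*} [AddCommGroup A]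
    [AddCommGroup B] [AddCommGroup C] [Module R A] [Module R B] [Module R C]
    (f : A →ₗ[R] B) (g : B →ₗ[R] C) (hfg : ∀ b, g b = 0 → ∃ a, f a = b)
    (hA : Module.Finite R A) (hC : Module.Finite R C) : Module.Finite R B := by
  refine ⟨Submodule.fg_of_fg_map_of_fg_inf_ker g (IsNoetherian.noetherian _) ?_⟩
  rw [top_inf_eq]
  have : IsNoetherian R (LinearMap.range f) := isNoetherian_of_isNoetherianRing_of_finite R _
  exact isNoetherian_submodule.mp this _ fun b hb ↦ hfg b hb

variable (I : Ideal R)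

section Sequence

variable {A B C : Type u} [AddCommGroup A] [AddCommGroup B] [AddCommGroup C]
  [Module R A] [Module R B] [Module R C]

/-- Functoriality of `Ext^n(R/I, -)`. -/
noncomputable abbrev extQuotMap (f : A →ₗ[R] B) (n : ℕ) : ExtQuot I A n →ₗ[R] ExtQuot I B n :=
  (Abelian.Ext.mk₀ (ModuleCat.ofHom f)).postcompOfLinear R _ (add_zero n)

lemma extQuotMap_comp (f : A →ₗ[R] B) (g : B →ₗ[R] C) (n : ℕ) (x : ExtQuot I A n) :
    extQuotMap I (g ∘ₗ f) n x = extQuotMap I g n (extQuotMap I f n x) := by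
  simp [ModuleCat.ofHom_comp, ← Abelian.Ext.mk₀_comp_mk₀]

lemma extQuotMap_id (n : ℕ) (x : ExtQuot I A n) :
    extQuotMap I (LinearMap.id : A →ₗ[R] A) n x = x := by
  simp

lemma extQuotMap_smul (r : R) (f : A →ₗ[R] B) (n : ℕ) (x : ExtQuot I A n) :
    extQuotMap I (r • f) n x = r • extQuotMap I f n x := by
  have h : ModuleCat.ofHom (r • f) = r • ModuleCat.ofHom f := rfl
  simp [h, Abelian.Ext.mk₀_smul]

/-- `Ext^n(R/I, -)` of a linear equivalence. -/
noncomputable def extQuotEquiv (e : A ≃ₗ[R] B) (n : ℕ) : ExtQuot I A n ≃ₗ[R] ExtQuot I B n :=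
  LinearEquiv.ofLinearMap (extQuotMap I e.toLinearMap n) (extQuotMap I e.symm.toLinearMap n)
    (by
      ext x
      rw [LinearMap.comp_apply, ← extQuotMap_comp]
      simp)
    (by
      ext x
      rw [LinearMap.comp_apply, ← extQuotMap_comp]
      simp)

/-- An element of `I` acts as zero on `R/I`, hence on `Ext^n(R/I, -)`. -/
lemma smul_extQuot_eq_zero {x : R} (hx : x ∈ I) (n : ℕ) (y : ExtQuot I A n) : x • y = 0 := by
  have h0 : x • 𝟙 (ModuleCat.of R (R ⧸ I)) = 0 := by
    apply ModuleCat.hom_ext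
    apply LinearMap.ext
    rintro ⟨y⟩
    exact Ideal.Quotient.eq_zero_iff_mem.mpr (I.mul_mem_right _ hx)
  calc x • y = x • (Abelian.Ext.mk₀ (𝟙 _)).comp y (zero_add n) := by simp
    _ = 0 := by rw [← Abelian.Ext.smul_comp, ← Abelian.Ext.mk₀_smul, h0]; simp

variable {f : A →ₗ[R] B} {g : B →ₗ[R] C}

lemma shortExact_of_exact (hf : Function.Injective f) (hg : Function.Surjective g)
    (h : Function.Exact f g) :
    (ShortComplex.moduleCatMk f g h.linearMap_comp_eq_zero).ShortExact :=
  ModuleCat.shortComplex_shortExact _ h hf hg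

/-- The connecting map `Ext^n(R/I, C) → Ext^{n+1}(R/I, A)`. -/
noncomputable abbrev extQuotδ (hf : Function.Injective f) (hg : Function.Surjective g)
    (h : Function.Exact f g) (n : ℕ) : ExtQuot I C n →ₗ[R] ExtQuot I A (n + 1) :=
  (shortExact_of_exact hf hg h).extClass.postcompOfLinear R _ rfl

lemma extQuot_exact₁ (hf : Function.Injective f) (hg : Function.Surjective g)
    (h : Function.Exact f g) (n : ℕ) (x : ExtQuot I A (n + 1))
    (hx : extQuotMap I f (n + 1) x = 0) : ∃ y, extQuotδ I hf hg h n y = x :=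
  Abelian.Ext.covariant_sequence_exact₁ _ (shortExact_of_exact hf hg h) x hx rfl

lemma extQuot_exact₂ (hf : Function.Injective f) (hg : Function.Surjective g)
    (h : Function.Exact f g) (n : ℕ) (x : ExtQuot I B n)
    (hx : extQuotMap I g n x = 0) : ∃ y, extQuotMap I f n y = x :=
  Abelian.Ext.covariant_sequence_exact₂ _ (shortExact_of_exact hf hg h) x hx

lemma extQuot_exact₃ (hf : Function.Injective f) (hg : Function.Surjective g)
    (h : Function.Exact f g) (n : ℕ) (x : ExtQuot I C n)
    (hx : extQuotδ I hf hg h n x = 0) : ∃ y, extQuotMap I g n y = x :=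
  Abelian.Ext.covariant_sequence_exact₃ _ (shortExact_of_exact hf hg h) x rfl hx

lemma extQuotMap_zero_injective (hf : Function.Injective f) :
    Function.Injective (extQuotMap I f 0) := by
  have : Mono (ModuleCat.ofHom f) := (ModuleCat.mono_iff_injective _).mpr hf
  exact Abelian.Ext.postcomp_mk₀_injective_of_mono _ (ModuleCat.ofHom f)

end Sequence

/-- `Ext^n(R/I, L)` is finitely generated. -/
def ExtFin (n : ℕ) (L : Type u) [AddCommGroup L] [Module R L] : Prop :=
  Module.Finite R (ExtQuot I L n)

variable {I} {A B C : Type u} [AddCommGroup A] [AddCommGroup B]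
  [AddCommGroup C] [Module R A] [Module R B] [Module R C]

namespace ExtFin

lemma of_equiv {n : ℕ} (e : A ≃ₗ[R] B) (h : ExtFin I n A) : ExtFin I n B :=
  have : Module.Finite R (ExtQuot I A n) := h
  Module.Finite.equiv (extQuotEquiv I e n)

variable [IsNoetherianRing R]

lemma of_finite (n : ℕ) [Module.Finite R A] : ExtFin I n A :=
  have : Module.Finite R (ModuleCat.of R A) := ‹Module.Finite R A›
  have : Module.Finite R (ModuleCat.of R (R ⧸ I)) := inferInstanceAs (Module.Finite R (R ⧸ I))
  ModuleCat.finite_ext R (ModuleCat.of R (R ⧸ I)) (ModuleCat.of R A) n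

variable {f : A →ₗ[R] B} {g : B →ₗ[R] C}

lemma middle (hf : Function.Injective f) (hg : Function.Surjective g) (h : Function.Exact f g)
    {n : ℕ} (hA : ExtFin I n A) (hC : ExtFin I n C) : ExtFin I n B :=
  Module.Finite.of_exact_of_finite _ _ (extQuot_exact₂ I hf hg h n) hA hC

lemma right (hf : Function.Injective f) (hg : Function.Surjective g) (h : Function.Exact f g)
    {n : ℕ} (hB : ExtFin I n B) (hA : ExtFin I (n + 1) A) : ExtFin I n C :=
  Module.Finite.of_exact_of_finite _ _ (extQuot_exact₃ I hf hg h n) hB hA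

lemma left (hf : Function.Injective f) (hg : Function.Surjective g) (h : Function.Exact f g)
    {n : ℕ} (hC : ExtFin I n C) (hB : ExtFin I (n + 1) B) : ExtFin I (n + 1) A :=
  Module.Finite.of_exact_of_finite _ _ (extQuot_exact₁ I hf hg h n) hC hB

lemma zero_of_injective (hf : Function.Injective f) (hB : ExtFin I 0 B) : ExtFin I 0 A :=
  have : Module.Finite R (ExtQuot I B 0) := hB
  Module.Finite.of_injective _ (extQuotMap_zero_injective I hf)

/-- Multiplication by an element of `I` acts as zero on `Ext^n(R/I, -)`. This is why the finiteness
of all `Ext^n(R/I, -)` of the kernel and of the cokernel passes to the module itself. -/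
lemma of_ker_of_coker {x : R} (hx : x ∈ I)
    (hK : ∀ n, ExtFin I n (LinearMap.ker (LinearMap.lsmul R A x)))
    (hC : ∀ n, ExtFin I n (A ⧸ LinearMap.range (LinearMap.lsmul R A x))) (n : ℕ) :
    ExtFin I n A := by
  set m := LinearMap.lsmul R A x
  let p : A →ₗ[R] LinearMap.range m := m.rangeRestrict
  let j : LinearMap.range m →ₗ[R] A := (LinearMap.range m).subtype
  have hjp : j ∘ₗ p = x • LinearMap.id := rfl
  have hz (y : ExtQuot I A n) : extQuotMap I j n (extQuotMap I p n y) = 0 := by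
    rw [← extQuotMap_comp, hjp, extQuotMap_smul, extQuotMap_id]
    exact smul_extQuot_eq_zero I hx n y
  have hp := LinearMap.exact_subtype_ker_rangeRestrict m
  have hj : Function.Exact j (LinearMap.range m).mkQ := LinearMap.exact_subtype_mkQ _
  -- The image of `Ext^n(p)` lies in the kernel of `Ext^n(j)`, which the cokernel controls.
  have hker : Module.Finite R (LinearMap.ker (extQuotMap I j n)) := by
    cases n with
    | zero =>
      have h : LinearMap.ker (extQuotMap I j 0) = ⊥ :=
        LinearMap.ker_eq_bot.mpr (extQuotMap_zero_injective I Subtype.val_injective)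
      rw [h]
      infer_instance
    | succ n =>
      have : Module.Finite R (ExtQuot I (A ⧸ LinearMap.range m) n) := hC n
      have h : LinearMap.ker (extQuotMap I j (n + 1)) ≤
          LinearMap.range (extQuotδ I (LinearMap.range m).injective_subtype
            (LinearMap.range m).mkQ_surjective hj n) :=
        fun y hy ↦ extQuot_exact₁ I _ _ hj n y hy
      exact Module.Finite.of_injective _ (Submodule.inclusion_injective h)
  refine Module.Finite.of_exact_of_finite
    (extQuotMap I (LinearMap.ker m).subtype n)
    ((extQuotMap I p n).codRestrict (LinearMap.ker (extQuotMap I j n)) hz) ?_ (hK n) hker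
  intro b hb
  exact extQuot_exact₂ I (LinearMap.ker m).injective_subtype m.surjective_rangeRestrict hp n b
    (congrArg Subtype.val hb)

end ExtFin

end FiniteExt

/-! ### Elements annihilated by an ideal -/

section Socle

variable {R : Type u} [CommRing R] (I : Ideal R)

/-- The submodule of elements annihilated by every element of `s`. -/
def annihilatedBy (s : Set R) (L : Type*) [AddCommGroup L] [Module R L] : Submodule R L where
  carrier := {y | ∀ a ∈ s, a • y = 0}
  add_mem' ha hb c hc := by rw [smul_add, ha c hc, hb c hc, add_zero]
  zero_mem' c _ := smul_zero c
  smul_mem' r y hy c hc := by rw [smul_comm, hy c hc, smul_zero]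

variable (L : Type u) [AddCommGroup L] [Module R L]

/-- Evaluation at `1` identifies `Hom(R/I, L)` with the elements annihilated by `I`. -/
noncomputable def homQuotEquiv (L : Type*) [AddCommGroup L] [Module R L] :
    ((R ⧸ I) →ₗ[R] L) ≃ₗ[R] annihilatedBy (I : Set R) L where
  toFun φ := ⟨φ 1, fun a ha ↦ by
    have h : a • (1 : R ⧸ I) = 0 := by
      rw [Algebra.smul_def, mul_one]
      exact Ideal.Quotient.eq_zero_iff_mem.mpr ha
    rw [← map_smul, h, map_zero]⟩
  map_add' _ _ := rfl
  map_smul' _ _ := rfl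
  invFun y := Submodule.liftQ I (LinearMap.toSpanSingleton R L y) fun a ha ↦ by
    simpa using y.2 a ha
  left_inv φ := by
    apply LinearMap.ext
    intro x
    obtain ⟨x, rfl⟩ := Ideal.Quotient.mk_surjective x
    have h : (Ideal.Quotient.mk I x) = x • (1 : R ⧸ I) := by
      rw [Algebra.smul_def, mul_one]; rfl
    have h2 : ∀ ψ : (R ⧸ I) →ₗ[R] L, ψ (Ideal.Quotient.mk I x) = x • ψ 1 := fun ψ ↦ by
      rw [h, map_smul]
    rw [h2, h2]
    congr 1
    exact one_smul R _
  right_inv y := Subtype.ext (one_smul R _)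

/-- `Ext^0(R/I, L)` is the module of elements annihilated by `I`. -/
noncomputable def extZeroEquiv :
    ExtQuot I L 0 ≃ₗ[R] annihilatedBy (I : Set R) L :=
  Abelian.Ext.linearEquiv₀.trans (ModuleCat.homLinearEquiv (S := R)) ≪≫ₗ homQuotEquiv I L

variable {I L}

lemma extFin_zero_iff : ExtFin I 0 L ↔ Module.Finite R (annihilatedBy (I : Set R) L) :=
  Module.Finite.equiv_iff (extZeroEquiv I L)

lemma finite_hom_iff : Module.Finite R ((R ⧸ I) →ₗ[R] L) ↔ ExtFin I 0 L :=
  (Module.Finite.equiv_iff (homQuotEquiv I L)).trans extFin_zero_iff.symm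

end Socle

/-! ### Torsion modules -/

section PowTorsion

variable {R : Type u} [CommRing R] (I : Ideal R)

/-- Every element of `L` is annihilated by a power of `I`. -/
def IsPowTorsion (L : Type*) [AddCommGroup L] [Module R L] : Prop :=
  ∀ y : L, ∃ n, ∀ a ∈ I ^ n, a • y = 0

/-- `Γ_I(L)`, the submodule of elements annihilated by a power of `I`. -/
def powTorsion (L : Type*) [AddCommGroup L] [Module R L] : Submodule R L where
  carrier := {y | ∃ n, ∀ a ∈ I ^ n, a • y = 0}
  add_mem' := by
    rintro y z ⟨n, hn⟩ ⟨m, hm⟩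
    refine ⟨max n m, fun a ha ↦ ?_⟩
    rw [smul_add, hn a (Ideal.pow_le_pow_right (le_max_left n m) ha),
      hm a (Ideal.pow_le_pow_right (le_max_right n m) ha), add_zero]
  zero_mem' := ⟨0, fun a _ ↦ smul_zero a⟩
  smul_mem' := by
    rintro r y ⟨n, hn⟩
    exact ⟨n, fun a ha ↦ by rw [smul_comm, hn a ha, smul_zero]⟩

variable {I} {L L' : Type*} [AddCommGroup L] [Module R L] [AddCommGroup L'] [Module R L']

namespace IsPowTorsion

lemma of_injective (h : IsPowTorsion I L') {f : L →ₗ[R] L'} (hf : Function.Injective f) :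
    IsPowTorsion I L := by
  intro y
  obtain ⟨n, hn⟩ := h (f y)
  exact ⟨n, fun a ha ↦ hf (by rw [map_smul, hn a ha, map_zero])⟩

lemma of_surjective (h : IsPowTorsion I L) {f : L →ₗ[R] L'} (hf : Function.Surjective f) :
    IsPowTorsion I L' := by
  intro y
  obtain ⟨y, rfl⟩ := hf y
  obtain ⟨n, hn⟩ := h y
  exact ⟨n, fun a ha ↦ by rw [← map_smul, hn a ha, map_zero]⟩

lemma submodule (h : IsPowTorsion I L) (N : Submodule R L) : IsPowTorsion I N :=
  h.of_injective N.injective_subtype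

lemma quotient (h : IsPowTorsion I L) (N : Submodule R L) : IsPowTorsion I (L ⧸ N) :=
  h.of_surjective N.mkQ_surjective

lemma exists_pow_smul_eq_zero (h : IsPowTorsion I L) {x : R} (hx : x ∈ I) (y : L) :
    ∃ n : ℕ, x ^ n • y = 0 :=
  (h y).imp fun _ hn ↦ hn _ (Ideal.pow_mem_pow hx _)

/-- A single power of `I` annihilates a finitely generated torsion module. -/
lemma exists_pow_le_annihilator (h : IsPowTorsion I L) [Module.Finite R L] :
    ∃ n, ∀ a ∈ I ^ n, ∀ y : L, a • y = 0 := by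
  obtain ⟨s, hs⟩ := Module.Finite.fg_top (R := R) (M := L)
  choose n hn using h
  refine ⟨s.sup n, fun a ha y ↦ ?_⟩
  have hy : y ∈ Submodule.span R (s : Set L) := hs ▸ Submodule.mem_top
  induction hy using Submodule.span_induction with
  | mem y hy => exact hn y a (Ideal.pow_le_pow_right (Finset.le_sup hy) ha)
  | zero => exact smul_zero a
  | add y z _ _ hy hz => rw [smul_add, hy, hz, add_zero]
  | smul r y _ hy => rw [smul_comm, hy, smul_zero]

lemma support_subset (h : IsPowTorsion I L) :
    Module.support R L ⊆ PrimeSpectrum.zeroLocus (I : Set R) := by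
  intro p hp a ha
  obtain ⟨y, hy⟩ := Module.mem_support_iff_exists_annihilator.mp hp
  obtain ⟨n, hn⟩ := h.exists_pow_smul_eq_zero ha y
  exact p.2.mem_of_pow_mem n (hy (Submodule.mem_annihilator_span_singleton _ _ |>.mpr hn))

end IsPowTorsion

lemma isPowTorsion_powTorsion : IsPowTorsion I (powTorsion I L) := by
  rintro ⟨y, n, hn⟩
  exact ⟨n, fun a ha ↦ Subtype.ext (hn a ha)⟩

/-- `Γ_I(L/Γ_I(L)) = 0`. This needs `I` to be finitely generated. -/
lemma powTorsion_quotient_eq_bot [IsNoetherianRing R] :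
    powTorsion I (L ⧸ powTorsion I L) = ⊥ := by
  rw [eq_bot_iff]
  rintro y ⟨n, hn⟩
  obtain ⟨y, rfl⟩ := (powTorsion I L).mkQ_surjective y
  rw [Submodule.mem_bot, Submodule.mkQ_apply, Submodule.Quotient.mk_eq_zero]
  -- The submodule `I ^ n • y` is finitely generated, so a power of `I` annihilates it.
  let f : ↥(I ^ n) →ₗ[R] powTorsion I L :=
    ((LinearMap.toSpanSingleton R L y).comp (I ^ n).subtype).codRestrict _ fun a ↦ by
      have h := hn a a.2
      rw [← map_smul, Submodule.mkQ_apply, Submodule.Quotient.mk_eq_zero] at h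
      exact h
  obtain ⟨m, hm⟩ := (isPowTorsion_powTorsion (I := I) (L := L)).submodule
    (LinearMap.range f) |>.exists_pow_le_annihilator
  refine ⟨m + n, fun a ha ↦ ?_⟩
  rw [pow_add] at ha
  refine Submodule.mul_induction_on ha (fun b hb c hc ↦ ?_) fun b c hb hc ↦ ?_
  · rw [mul_smul]
    exact congrArg (fun z : LinearMap.range f ↦ ((z : powTorsion I L) : L))
      (hm b hb ⟨f ⟨c, hc⟩, ⟨c, hc⟩, rfl⟩)
  · rw [add_smul, hb, hc, add_zero]

lemma annihilatedBy_eq_bot_of_powTorsion_eq_bot {J : Ideal R} {n : ℕ} (hJ : I ^ n ≤ J)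
    (h : powTorsion I L = ⊥) : annihilatedBy (J : Set R) L = ⊥ := by
  rw [eq_bot_iff, ← h]
  exact fun y hy ↦ ⟨n, fun a ha ↦ hy a (hJ ha)⟩

/-- Over a Noetherian ring `Γ_I` of an injective module is injective. By the Artin–Rees lemma a map
`J → Γ_I(E)` factors through the image of `J` in `R/I^m` for some `m`, and it extends to `R/I^m`
inside `E`, hence inside `Γ_I(E)`. -/
lemma injective_powTorsion [IsNoetherianRing R] (E : Type u) [AddCommGroup E] [Module R E]
    [Module.Injective R E] : Module.Injective R (powTorsion I E) := by
  apply Module.Baer.injective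
  intro J g
  obtain ⟨n, hn⟩ := (isPowTorsion_powTorsion (I := I) (L := E)).submodule
    (LinearMap.range g) |>.exists_pow_le_annihilator
  obtain ⟨k, hk⟩ := Ideal.exists_pow_inf_eq_pow_smul I J
  let m := n + k
  let q : J →ₗ[R] R ⧸ I ^ m := (I ^ m).mkQ ∘ₗ J.subtype
  have hq : LinearMap.ker q ≤ LinearMap.ker g := by
    rintro ⟨x, hxJ⟩ hx
    have hxm : x ∈ I ^ m • (⊤ : Submodule R R) ⊓ J := by
      refine ⟨?_, hxJ⟩
      have h : (I ^ m).mkQ x = 0 := hx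
      rw [Submodule.mkQ_apply, Submodule.Quotient.mk_eq_zero] at h
      simpa using h
    rw [hk m (Nat.le_add_left k n)] at hxm
    have hxn : x ∈ I ^ n • J := by
      have h : m - k = n := Nat.add_sub_cancel n k
      rw [h] at hxm
      exact Submodule.smul_mono le_rfl inf_le_right hxm
    have key : ∀ x ∈ I ^ n • J, ∃ hx : x ∈ J, g ⟨x, hx⟩ = 0 := by
      intro x hx
      refine Submodule.smul_induction_on hx (fun a ha b hb ↦ ?_) ?_
      · refine ⟨J.smul_mem a hb, ?_⟩
        have h : (⟨a • b, J.smul_mem a hb⟩ : J) = a • ⟨b, hb⟩ := rfl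
        rw [h, map_smul]
        exact congrArg Subtype.val (hn a ha ⟨g ⟨b, hb⟩, ⟨b, hb⟩, rfl⟩)
      · rintro y z ⟨hy, hgy⟩ ⟨hz, hgz⟩
        refine ⟨J.add_mem hy hz, ?_⟩
        have h : (⟨y + z, J.add_mem hy hz⟩ : J) = ⟨y, hy⟩ + ⟨z, hz⟩ := rfl
        rw [h, map_add, hgy, hgz, add_zero]
    exact (key x hxn).2
  obtain ⟨h, hh⟩ := Module.Injective.out ((LinearMap.ker q).liftQ q le_rfl)
    (LinearMap.ker_eq_bot.mp (Submodule.ker_liftQ_eq_bot _ _ _ le_rfl))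
    ((powTorsion I E).subtype ∘ₗ (LinearMap.ker q).liftQ g hq)
  refine ⟨(h ∘ₗ (I ^ m).mkQ).codRestrict _ fun x ↦ ⟨m, fun a ha ↦ ?_⟩, fun x hx ↦ ?_⟩
  · have h0 : (I ^ m).mkQ (a • x) = 0 := by
      rw [Submodule.mkQ_apply, Submodule.Quotient.mk_eq_zero]
      exact (I ^ m).mul_mem_right _ ha
    rw [LinearMap.comp_apply, ← map_smul, ← map_smul, h0, map_zero]
  · exact Subtype.ext (hh (Submodule.Quotient.mk ⟨x, hx⟩))

end PowTorsion

/-! ### Dimension shifting for local cohomology -/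

section Shift

variable {R : Type u} [CommRing R] (I : Ideal R)

variable {A B C : Type u} [AddCommGroup A] [AddCommGroup B] [AddCommGroup C]
  [Module R A] [Module R B] [Module R C] {f : A →ₗ[R] B} {g : B →ₗ[R] C}

lemma extPowMap_extQuotMap (f : A →ₗ[R] B) (i n m : ℕ) (h : n ≤ m) (x : ExtPow I i A n) :
    extPowMap I i B n m h (extQuotMap (I ^ n) f i x) =
      extQuotMap (I ^ m) f i (extPowMap I i A n m h x) := by
  simp

lemma extPowMap_extQuotδ (hf : Function.Injective f) (hg : Function.Surjective g)
    (hfg : Function.Exact f g) (i n m : ℕ) (h : n ≤ m) (x : ExtPow I i C n) :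
    extPowMap I (i + 1) A n m h (extQuotδ (I ^ n) hf hg hfg i x) =
      extQuotδ (I ^ m) hf hg hfg i (extPowMap I i C n m h x) :=
  (Abelian.Ext.comp_assoc (Abelian.Ext.mk₀ (powQuotMap I h)) x
    (shortExact_of_exact hf hg hfg).extClass (zero_add i) rfl (by omega)).symm

lemma extQuotδ_extQuotMap (hf : Function.Injective f) (hg : Function.Surjective g)
    (hfg : Function.Exact f g) (n : ℕ) (x : ExtQuot I B n) :
    extQuotδ I hf hg hfg n (extQuotMap I g n x) = 0 :=
  (Abelian.Ext.comp_assoc_of_second_deg_zero _ _ _ _).trans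
    (congrArg (Abelian.Ext.comp x · rfl) (shortExact_of_exact hf hg hfg).comp_extClass |>.trans
      (Abelian.Ext.comp_zero x _ _ _ _))

lemma coe_extZeroEquiv_extQuotMap (f : A →ₗ[R] B) (x : ExtQuot I A 0) :
    (extZeroEquiv I B (extQuotMap I f 0 x) : B) = f (extZeroEquiv I A x) := by
  obtain ⟨φ, rfl⟩ := Abelian.Ext.linearEquiv₀ (R := R) |>.symm.surjective x
  have h : extQuotMap I f 0 (Abelian.Ext.linearEquiv₀ (R := R) |>.symm φ) =
      (Abelian.Ext.linearEquiv₀ (R := R)).symm (φ ≫ ModuleCat.ofHom f) := by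
    simp
  rw [h]
  simp only [extZeroEquiv, LinearEquiv.trans_apply, LinearEquiv.apply_symm_apply]
  rfl

lemma coe_extZeroEquiv_extPowMap {n m : ℕ} (h : n ≤ m) (x : ExtPow I 0 A n) :
    (extZeroEquiv (I ^ m) A (extPowMap I 0 A n m h x) : A) = extZeroEquiv (I ^ n) A x := by
  obtain ⟨φ, rfl⟩ := Abelian.Ext.linearEquiv₀ (R := R) |>.symm.surjective x
  have h : extPowMap I 0 A n m h (Abelian.Ext.linearEquiv₀ (R := R) |>.symm φ) =
      (Abelian.Ext.linearEquiv₀ (R := R)).symm (powQuotMap I h ≫ φ) := by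
    simp
  rw [h]
  simp only [extZeroEquiv, LinearEquiv.trans_apply, LinearEquiv.apply_symm_apply]
  rfl

variable {I}

/-- Dimension shifting along `0 → A → B → C → 0` when `B` has no `Ext` from the modules
`R/I^n`. -/
noncomputable def extLimShift (hf : Function.Injective f) (hg : Function.Surjective g)
    (hfg : Function.Exact f g) (hB : ∀ i n, Subsingleton (ExtPow I i B n)) (i : ℕ) :
    ExtLim I i C ≃ₗ[R] ExtLim I (i + 1) A :=
  Module.DirectLimit.congr
    (fun n ↦ LinearEquiv.ofBijective (extQuotδ (I ^ n) hf hg hfg i) ⟨by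
      rw [injective_iff_map_eq_zero]
      intro x hx
      obtain ⟨y, rfl⟩ := extQuot_exact₃ (I ^ n) hf hg hfg i x hx
      have := hB i n
      rw [Subsingleton.elim y 0, map_zero], fun x ↦
      have := hB (i + 1) n
      extQuot_exact₁ (I ^ n) hf hg hfg i x (Subsingleton.elim _ _)⟩)
    (fun n m h ↦ LinearMap.ext fun x ↦ (extPowMap_extQuotδ I hf hg hfg i n m h x).symm)

/-- The functoriality of `ExtLim`. -/
noncomputable def extLimMap (f : A →ₗ[R] B) (i : ℕ) : ExtLim I i A →ₗ[R] ExtLim I i B :=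
  Module.DirectLimit.map (fun n ↦ extQuotMap (I ^ n) f i)
    (fun n m h ↦ LinearMap.ext fun x ↦ (extPowMap_extQuotMap I f i n m h x).symm)

lemma extLimMap_of (f : A →ₗ[R] B) (i n : ℕ) (x : ExtPow I i A n) :
    extLimMap f i (Module.DirectLimit.of R ℕ (ExtPow I i A) (extPowMap I i A) n x) =
      Module.DirectLimit.of R ℕ (ExtPow I i B) (extPowMap I i B) n (extQuotMap (I ^ n) f i x) :=
  Module.DirectLimit.map_apply_of _ _ _

lemma annihilatedBy_pow_le_powTorsion (n : ℕ) :
    annihilatedBy ((I ^ n : Ideal R) : Set R) A ≤ powTorsion I A :=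
  fun _ hy ↦ ⟨n, hy⟩

variable (I A) in
/-- `H^0_I(A)` is `Γ_I(A)`. -/
noncomputable def extLimZeroEquiv : ExtLim I 0 A ≃ₗ[R] powTorsion I A :=
  LinearEquiv.ofBijective
    (Module.DirectLimit.lift R ℕ _ _
      (fun n ↦ Submodule.inclusion (annihilatedBy_pow_le_powTorsion n) ∘ₗ
        (extZeroEquiv (I ^ n) A).toLinearMap)
      (fun n m h x ↦ Subtype.ext (coe_extZeroEquiv_extPowMap I h x)))
    ⟨Module.DirectLimit.lift_injective _ _ fun n ↦
      (Submodule.inclusion_injective (annihilatedBy_pow_le_powTorsion n)).comp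
        (extZeroEquiv (I ^ n) A).injective, by
      rintro ⟨y, n, hn⟩
      refine ⟨Module.DirectLimit.of R ℕ _ _ n ((extZeroEquiv (I ^ n) A).symm ⟨y, hn⟩), ?_⟩
      rw [Module.DirectLimit.lift_of]
      ext
      rw [LinearMap.comp_apply, LinearEquiv.coe_coe, LinearEquiv.apply_symm_apply]
      rfl⟩

lemma isPowTorsion_extLim (i : ℕ) : IsPowTorsion I (ExtLim I i A) := by
  intro z
  obtain ⟨n, x, rfl⟩ := Module.DirectLimit.exists_of z
  refine ⟨n, fun a ha ↦ ?_⟩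
  rw [← map_smul]
  exact (congrArg _ (smul_extQuot_eq_zero (I ^ n) ha i x)).trans (map_zero _)

variable (A) in
lemma exists_injective_embedding : ∃ (E : Type u) (_ : AddCommGroup E) (_ : Module R E)
    (f : A →ₗ[R] E), Module.Injective R E ∧ Function.Injective f :=
  let E : ModuleCat.{u} R := Injective.under (ModuleCat.of R A)
  have : Injective (ModuleCat.of R E) := inferInstanceAs (Injective (Injective.under _))
  ⟨E, inferInstance, inferInstance, (Injective.ι (ModuleCat.of R A)).hom,
    Module.injective_module_of_injective_object R E,
    (ModuleCat.mono_iff_injective _).mp inferInstance⟩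

lemma subsingleton_extQuot_succ (J : Ideal R) [hA : Module.Injective R A] (n : ℕ) :
    Subsingleton (ExtQuot J A (n + 1)) :=
  have : Injective (ModuleCat.of R A) := Module.injective_object_of_injective_module R A
  ⟨fun x y ↦ (x.eq_zero_of_injective).trans (y.eq_zero_of_injective).symm⟩

variable [IsNoetherianRing R]

/-- A torsion module embeds in a torsion injective module, namely `Γ_I` of an injective module
containing it. -/
lemma IsPowTorsion.exists_injective_embedding {A : Type u} [AddCommGroup A] [Module R A]
    (hA : IsPowTorsion I A) : ∃ (E : Type u) (_ : AddCommGroup E) (_ : Module R E)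
      (f : A →ₗ[R] E), Module.Injective R E ∧ IsPowTorsion I E ∧ Function.Injective f := by
  obtain ⟨E, _, _, f, hE, hf⟩ := _root_.exists_injective_embedding (R := R) A
  exact ⟨powTorsion I E, inferInstance, inferInstance,
    f.codRestrict _ fun y ↦ (hA y).imp fun k hk a ha ↦ by rw [← map_smul, hk a ha, map_zero],
    injective_powTorsion E, isPowTorsion_powTorsion, fun y z h ↦ hf (congrArg Subtype.val h)⟩

/-- A class of positive degree in `Ext^*(R/I^n, A)` with `A` torsion dies in `Ext^*(R/I^m, A)` for
some `m ≥ n`: local cohomology of torsion modules vanishes in positive degrees. -/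
lemma exists_extPowMap_eq_zero_of_isPowTorsion (i : ℕ) {A : Type u} [AddCommGroup A] [Module R A]
    (hA : IsPowTorsion I A) (n : ℕ) (x : ExtPow I (i + 1) A n) :
    ∃ m, ∃ h : n ≤ m, extPowMap I (i + 1) A n m h x = 0 := by
  induction i generalizing A n with
  | zero =>
    obtain ⟨E, _, _, f, hE, hEt, hf⟩ := hA.exists_injective_embedding
    have hg := (LinearMap.range f).mkQ_surjective
    have hfg := LinearMap.exact_map_mkQ_range f
    have := subsingleton_extQuot_succ (A := E) (I ^ n) 0
    obtain ⟨y, rfl⟩ := extQuot_exact₁ (I ^ n) hf hg hfg 0 x (Subsingleton.elim _ _)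
    -- In degree `0` the class is an element of `E / A`; its lift to `E` is annihilated by some `I^k`.
    obtain ⟨z, hz⟩ := hg (extZeroEquiv (I ^ n) _ y)
    obtain ⟨k, hk⟩ := hEt z
    have hmk : I ^ max n k ≤ I ^ k := Ideal.pow_le_pow_right (le_max_right n k)
    let w := (extZeroEquiv (I ^ max n k) E).symm
      ⟨z, fun a ha ↦ hk a (hmk ha)⟩
    have hw : extPowMap I 0 _ n (max n k) (le_max_left n k) y =
        extQuotMap (I ^ max n k) (LinearMap.range f).mkQ 0 w := by
      apply (extZeroEquiv (I ^ max n k) _).injective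
      apply Subtype.ext
      rw [coe_extZeroEquiv_extPowMap, coe_extZeroEquiv_extQuotMap, ← hz]
      simp [w]
    refine ⟨max n k, le_max_left n k, ?_⟩
    rw [extPowMap_extQuotδ, hw, extQuotδ_extQuotMap]
  | succ i ih =>
    obtain ⟨E, _, _, f, hE, hEt, hf⟩ := hA.exists_injective_embedding
    have hg := (LinearMap.range f).mkQ_surjective
    have hfg := LinearMap.exact_map_mkQ_range f
    have := subsingleton_extQuot_succ (A := E) (I ^ n) (i + 1)
    obtain ⟨y, rfl⟩ := extQuot_exact₁ (I ^ n) hf hg hfg (i + 1) x (Subsingleton.elim _ _)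
    obtain ⟨m, h, hy⟩ := ih (hEt.quotient (LinearMap.range f)) n y
    exact ⟨m, h, by rw [extPowMap_extQuotδ, hy, map_zero]⟩

/-- Passing to the quotient by a torsion submodule does not change local cohomology in positive
degrees. -/
noncomputable def extLimQuotientEquiv (T : Submodule R A) (hT : IsPowTorsion I T) (i : ℕ) :
    ExtLim I (i + 1) A ≃ₗ[R] ExtLim I (i + 1) (A ⧸ T) :=
  LinearEquiv.ofBijective (extLimMap T.mkQ (i + 1)) (by
    have hfg : Function.Exact T.subtype T.mkQ := LinearMap.exact_subtype_mkQ _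
    constructor
    · rw [injective_iff_map_eq_zero]
      intro z hz
      obtain ⟨n, x, rfl⟩ := Module.DirectLimit.exists_of z
      rw [extLimMap_of] at hz
      obtain ⟨m, h, hm⟩ := exists_extPowMap_eq_zero hz
      rw [extPowMap_extQuotMap] at hm
      obtain ⟨y, hy⟩ := extQuot_exact₂ (I ^ m) T.injective_subtype T.mkQ_surjective hfg _ _ hm
      obtain ⟨k, h', hk⟩ := exists_extPowMap_eq_zero_of_isPowTorsion i hT m y
      rw [← Module.DirectLimit.of_f (hij := h), ← hy, ← Module.DirectLimit.of_f (hij := h'),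
        extPowMap_extQuotMap, hk, map_zero, map_zero]
    · intro z
      obtain ⟨n, x, rfl⟩ := Module.DirectLimit.exists_of z
      obtain ⟨k, h, hk⟩ := exists_extPowMap_eq_zero_of_isPowTorsion (i + 1) hT n
        (extQuotδ (I ^ n) T.injective_subtype T.mkQ_surjective hfg _ x)
      rw [extPowMap_extQuotδ] at hk
      obtain ⟨y, hy⟩ := extQuot_exact₃ (I ^ k) T.injective_subtype T.mkQ_surjective hfg _ _ hk
      exact ⟨Module.DirectLimit.of R ℕ _ _ k y, by
        rw [extLimMap_of, hy, Module.DirectLimit.of_f]⟩)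

/-- For `E` injective, `E/Γ_I(E)` has no `Ext` from quotients of the rings `R/I^n`. -/
lemma subsingleton_extQuot_quotient_powTorsion [Module.Injective R A] {J : Ideal R} {n : ℕ}
    (hJ : I ^ n ≤ J) (i : ℕ) : Subsingleton (ExtQuot J (A ⧸ powTorsion I A) i) := by
  cases i with
  | zero =>
    have := annihilatedBy_eq_bot_of_powTorsion_eq_bot hJ (powTorsion_quotient_eq_bot (L := A))
    have h := (Submodule.subsingleton_iff_eq_bot).mpr this
    exact (extZeroEquiv J _).toEquiv.subsingleton
  | succ i =>
    have hfg := LinearMap.exact_subtype_mkQ (powTorsion I A)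
    have := injective_powTorsion (I := I) A
    have h1 := subsingleton_extQuot_succ (A := A) J i
    have h2 := subsingleton_extQuot_succ (A := powTorsion I A) J (i + 1)
    refine subsingleton_of_forall_eq 0 fun x ↦ ?_
    obtain ⟨y, rfl⟩ := extQuot_exact₃ J (powTorsion I A).injective_subtype
      (powTorsion I A).mkQ_surjective hfg (i + 1) x (Subsingleton.elim _ _)
    rw [Subsingleton.elim y 0, map_zero]

/-- If the local cohomology modules of `M` below degree `t` have finitely generated
`Ext^j(R/I, -)`, then so has the one in degree `t` for `j ≤ 1`. Dividing by `Γ_I(M)` and then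
embedding into an injective module without `I`-torsion lowers `t`. -/
theorem extFin_extLim_of_forall_lt (t : ℕ) {M : Type u} [AddCommGroup M] [Module R M]
    (hM : ∀ j, ExtFin I j M) (ht : ∀ i < t, ∀ j, ExtFin I j (ExtLim I i M)) :
    ExtFin I 0 (ExtLim I t M) ∧ ExtFin I 1 (ExtLim I t M) := by
  induction t generalizing M with
  | zero =>
    have hbot := annihilatedBy_eq_bot_of_powTorsion_eq_bot (J := I) (n := 1) (by simp)
      (powTorsion_quotient_eq_bot (I := I) (L := M))
    have h0 : ExtFin I 0 (M ⧸ powTorsion I M) := by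
      rw [extFin_zero_iff, hbot]
      infer_instance
    have hfg := LinearMap.exact_subtype_mkQ (powTorsion I M)
    exact ⟨(ExtFin.zero_of_injective (powTorsion I M).injective_subtype (hM 0)).of_equiv
        (extLimZeroEquiv I M).symm,
      (ExtFin.left (powTorsion I M).injective_subtype (powTorsion I M).mkQ_surjective hfg
        h0 (hM 1)).of_equiv (extLimZeroEquiv I M).symm⟩
  | succ t ih =>
    let M' := M ⧸ powTorsion I M
    have hfg := LinearMap.exact_subtype_mkQ (powTorsion I M)
    have hM' (j : ℕ) : ExtFin I j M' :=
      ExtFin.right (powTorsion I M).injective_subtype (powTorsion I M).mkQ_surjective hfg (hM j)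
        ((ht 0 (Nat.succ_pos t) (j + 1)).of_equiv (extLimZeroEquiv I M))
    obtain ⟨E, _, _, f, hE, hf⟩ := exists_injective_embedding (R := R) M'
    let E' := E ⧸ powTorsion I E
    let f' : M' →ₗ[R] E' := (powTorsion I E).mkQ ∘ₗ f
    have hf' : Function.Injective f' := by
      rw [injective_iff_map_eq_zero]
      intro y hy
      have hy' : f y ∈ powTorsion I E := (Submodule.Quotient.mk_eq_zero _).mp hy
      have hyt : y ∈ powTorsion I M' := hy'.imp fun k hk a ha ↦
        hf (by rw [map_smul, hk a ha, map_zero])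
      rwa [powTorsion_quotient_eq_bot, Submodule.mem_bot] at hyt
    have hg := (LinearMap.range f').mkQ_surjective
    have hfg' : Function.Exact f' (LinearMap.range f').mkQ := LinearMap.exact_map_mkQ_range _
    let C := E' ⧸ LinearMap.range f'
    have hC (j : ℕ) : ExtFin I j C := by
      have := subsingleton_extQuot_quotient_powTorsion (A := E) (I := I) (J := I) (n := 1)
        (by simp) j
      exact ExtFin.right hf' hg hfg' (inferInstanceAs (Module.Finite R (ExtQuot I E' j)))
        (hM' (j + 1))
    have e (i : ℕ) : ExtLim I i C ≃ₗ[R] ExtLim I (i + 1) M :=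
      extLimShift hf' hg hfg'
        (fun i n ↦ subsingleton_extQuot_quotient_powTorsion (A := E) le_rfl i) i ≪≫ₗ
      (extLimQuotientEquiv (powTorsion I M) isPowTorsion_powTorsion i).symm
    obtain ⟨h0, h1⟩ := ih hC fun i hi j ↦ (ht (i + 1) (by omega) j).of_equiv (e i).symm
    exact ⟨h0.of_equiv (e t), h1.of_equiv (e t)⟩

end Shift

/-! ### Artinian and finitely generated modules from their socles -/

section Artinian

variable {R : Type*} [CommRing R] {N : Type*} [AddCommGroup N] [Module R N]

/-- A module on which every element is annihilated by a power of `x` is Artinian as soon as the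
kernel of `x` is. A descending chain `f` is controlled by the double chain of the submodules
`ker x ∩ x^n f(k)` of `ker x`, which is stationary in `k` uniformly in `n`. -/
lemma isArtinian_of_isArtinian_ker_lsmul (x : R) (hx : ∀ y : N, ∃ n : ℕ, x ^ n • y = 0)
    (hK : IsArtinian R (LinearMap.ker (LinearMap.lsmul R N x))) : IsArtinian R N := by
  rw [← monotone_stabilizes_iff_artinian]
  intro f
  have hf {k l : ℕ} (h : k ≤ l) {a : N} (ha : a ∈ OrderDual.ofDual (f l)) :
      a ∈ OrderDual.ofDual (f k) := f.monotone h ha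
  let K := LinearMap.ker (LinearMap.lsmul R N x)
  let B (n k : ℕ) : Submodule R K :=
    ((OrderDual.ofDual (f k)).map (LinearMap.lsmul R N (x ^ n))).comap K.subtype
  have hB {n m k l : ℕ} (hnm : n ≤ m) (hkl : k ≤ l) : B m l ≤ B n k := by
    rintro z ⟨a, ha, haz⟩
    refine ⟨x ^ (m - n) • a, Submodule.smul_mem _ _ (hf hkl ha), ?_⟩
    rw [← haz]
    simp only [LinearMap.lsmul_apply, smul_smul, ← pow_add]
    congr 2
    omega
  obtain ⟨k₀, hk₀⟩ := IsArtinian.monotone_stabilizes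
    (⟨fun k ↦ OrderDual.toDual (B k k), fun k l h ↦ hB h h⟩ : ℕ →o (Submodule R K)ᵒᵈ)
  have hcol (n : ℕ) := IsArtinian.monotone_stabilizes
    (⟨fun k ↦ OrderDual.toDual (B n k), fun k l h ↦ hB le_rfl h⟩ : ℕ →o (Submodule R K)ᵒᵈ)
  choose κ hκ using hcol
  let k₁ := max k₀ ((Finset.range k₀).sup κ)
  have hstab (n k : ℕ) (hk : k₁ ≤ k) : B n k₁ ≤ B n k := by
    by_cases hn : k₀ ≤ n
    · have h : B k₀ k₀ = B (max n k) (max n k) := hk₀ _ (hn.trans (le_max_left n k))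
      exact (hB hn (le_max_left _ _)).trans (h.le.trans (hB (le_max_left _ _) (le_max_right _ _)))
    · have h1 : κ n ≤ k₁ :=
        (Finset.le_sup (f := κ) (Finset.mem_range.mpr (not_le.mp hn))).trans (le_max_right _ _)
      have h2 : B n (κ n) = B n k := hκ n k (h1.trans hk)
      exact (hB le_rfl h1).trans h2.le
  have key (k : ℕ) (hk : k₁ ≤ k) (n : ℕ) :
      ∀ a ∈ OrderDual.ofDual (f k₁), x ^ n • a = 0 → a ∈ OrderDual.ofDual (f k) := by
    induction n with
    | zero =>
      intro a _ h
      rw [pow_zero, one_smul] at h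
      rw [h]
      exact Submodule.zero_mem _
    | succ n ih =>
      intro a ha h
      have hz : x ^ n • a ∈ K := by
        rw [LinearMap.mem_ker, LinearMap.lsmul_apply, smul_smul, ← pow_succ', h]
      obtain ⟨b, hb, hab⟩ : (⟨x ^ n • a, hz⟩ : K) ∈ B n k := hstab n k hk ⟨a, ha, rfl⟩
      have hab' : x ^ n • b = x ^ n • a := hab
      have := ih (a - b) (Submodule.sub_mem _ ha (hf hk hb)) (by rw [smul_sub, hab', sub_self])
      simpa using Submodule.add_mem _ this hb
  refine ⟨k₁, fun k hk ↦ le_antisymm (f.monotone hk) fun a ha ↦ ?_⟩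
  obtain ⟨n, hn⟩ := hx a
  exact key k hk n a ha hn

/-- The elements of `ker x` annihilated by `s`, among those of `N` annihilated by `insert x s`. -/
def annihilatedByKer (x : R) (s : Set R) :
    annihilatedBy s (LinearMap.ker (LinearMap.lsmul R N x)) →ₗ[R]
      annihilatedBy (insert x s) N :=
  ((LinearMap.ker (LinearMap.lsmul R N x)).subtype ∘ₗ (annihilatedBy s _).subtype).codRestrict _
    fun y a ha ↦ by
      obtain rfl | ha := ha
      · exact y.1.2
      · exact congrArg Subtype.val (y.2 a ha)

lemma annihilatedByKer_injective (x : R) (s : Set R) :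
    Function.Injective (annihilatedByKer (N := N) x s) := by
  intro a b h
  have h' := congrArg Subtype.val h
  exact Subtype.ext (Subtype.ext h')

lemma annihilatedBy_empty : annihilatedBy (∅ : Set R) N = ⊤ :=
  eq_top_iff.mpr fun _ _ _ h ↦ h.elim

/-- Melkersson's criterion: if each element of the finite set `s` acts locally nilpotently, `N` is
Artinian as soon as the submodule annihilated by `s` is. -/
lemma isArtinian_of_isArtinian_annihilatedBy (s : Finset R) {N : Type*} [AddCommGroup N]
    [Module R N] (hs : ∀ x ∈ s, ∀ y : N, ∃ n : ℕ, x ^ n • y = 0)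
    (h : IsArtinian R (annihilatedBy (s : Set R) N)) : IsArtinian R N := by
  classical
  induction s using Finset.induction_on generalizing N with
  | empty =>
    rw [Finset.coe_empty, annihilatedBy_empty] at h
    exact isArtinian_of_linearEquiv Submodule.topEquiv
  | insert x s _ ih =>
    rw [Finset.coe_insert] at h
    refine isArtinian_of_isArtinian_ker_lsmul x (hs x (Finset.mem_insert_self x s)) (ih ?_
      (isArtinian_of_injective _ (annihilatedByKer_injective x s)))
    exact fun z hz y ↦ (hs z (Finset.mem_insert_of_mem hz) y).imp fun n hn ↦ Subtype.ext hn

lemma finite_of_finite_ker_lsmul [IsNoetherianRing R] (x : R) (n : ℕ) {N : Type*} [AddCommGroup N]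
    [Module R N] (hx : ∀ y : N, x ^ n • y = 0)
    (hK : Module.Finite R (LinearMap.ker (LinearMap.lsmul R N x))) : Module.Finite R N := by
  induction n generalizing N with
  | zero =>
    have : Subsingleton N := subsingleton_of_forall_eq 0 fun y ↦ by simpa using hx y
    infer_instance
  | succ n ih =>
    let P := LinearMap.range (LinearMap.lsmul R N x)
    have hP : Module.Finite R P := by
      refine ih ?_ ?_
      · rintro ⟨_, y, rfl⟩
        apply Subtype.ext
        change x ^ n • x • y = 0
        rw [smul_smul, ← pow_succ, hx]
      · let j : LinearMap.ker (LinearMap.lsmul R P x) →ₗ[R]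
            LinearMap.ker (LinearMap.lsmul R N x) :=
          (P.subtype ∘ₗ (LinearMap.ker (LinearMap.lsmul R P x)).subtype).codRestrict _
            fun y ↦ congrArg Subtype.val y.2
        refine Module.Finite.of_injective j fun a b h ↦ ?_
        have h' := congrArg Subtype.val h
        exact Subtype.ext (Subtype.ext h')
    exact Module.Finite.of_exact_of_finite (LinearMap.ker (LinearMap.lsmul R N x)).subtype
      (LinearMap.lsmul R N x).rangeRestrict (fun b hb ↦ ⟨⟨b, congrArg Subtype.val hb⟩, rfl⟩) hK hP

/-- The analogue for finite generation needs each element of `s` to act nilpotently. -/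
lemma finite_of_finite_annihilatedBy [IsNoetherianRing R] (s : Finset R) {N : Type*}
    [AddCommGroup N] [Module R N] (hs : ∀ x ∈ s, ∃ n : ℕ, ∀ y : N, x ^ n • y = 0)
    (h : Module.Finite R (annihilatedBy (s : Set R) N)) : Module.Finite R N := by
  classical
  induction s using Finset.induction_on generalizing N with
  | empty =>
    rw [Finset.coe_empty, annihilatedBy_empty] at h
    exact Module.Finite.equiv Submodule.topEquiv
  | insert x s _ ih =>
    rw [Finset.coe_insert] at h
    obtain ⟨n, hn⟩ := hs x (Finset.mem_insert_self x s)
    refine finite_of_finite_ker_lsmul x n hn (ih ?_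
      (Module.Finite.of_injective _ (annihilatedByKer_injective x s)))
    exact fun z hz ↦ (hs z (Finset.mem_insert_of_mem hz)).imp fun n hn y ↦ Subtype.ext (hn y)

lemma annihilatedBy_span (s : Set R) :
    annihilatedBy ((Ideal.span s : Ideal R) : Set R) N = annihilatedBy s N := by
  refine le_antisymm (fun y hy a ha ↦ hy a (Ideal.subset_span ha)) fun y hy a ha ↦ ?_
  induction ha using Submodule.span_induction with
  | mem a ha => exact hy a ha
  | zero => exact zero_smul R y
  | add a b _ _ ha hb => rw [add_smul, ha, hb, add_zero]
  | smul r a _ ha => rw [smul_assoc, ha, smul_zero]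

/-- A finitely generated module annihilated by a maximal ideal is Artinian. -/
lemma isArtinian_of_finite_of_isMaximal (m : Ideal R) [hm : m.IsMaximal] [Module.Finite R N]
    (h : ∀ a ∈ m, ∀ y : N, a • y = 0) : IsArtinian R N := by
  have hN : Module.IsTorsionBySet R N m := fun y a ↦ h a a.2 y
  let := hN.module
  have : IsScalarTower R (R ⧸ m) N := hN.isScalarTower
  let := Ideal.Quotient.field m
  have : Module.Finite (R ⧸ m) N := Module.Finite.of_restrictScalars_finite R (R ⧸ m) N
  exact isArtinian_of_surjective_algebraMap (S := R) (R := R ⧸ m) Ideal.Quotient.mk_surjective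

end Artinian

/-! ### Minimal primes of the support -/

section Support

variable {R : Type u} [CommRing R] {I : Ideal R} {N : Type u} [AddCommGroup N] [Module R N]

/-- `p` is a minimal element of the support of `N`. -/
def IsMinSupport (p : PrimeSpectrum R) (N : Type u) [AddCommGroup N] [Module R N] : Prop :=
  Minimal (· ∈ Module.support R N) p

/-- A prime of the support of a torsion module is in the support of the elements annihilated
by `I`. -/
lemma IsPowTorsion.support_annihilatedBy [IsNoetherianRing R] (hN : IsPowTorsion I N) :
    Module.support R (annihilatedBy (I : Set R) N) = Module.support R N := by
  refine (Module.support_subset_of_injective _ (Submodule.injective_subtype _)).antisymm ?_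
  intro p hp
  obtain ⟨y, hy⟩ := Module.mem_support_iff'.mp hp
  obtain ⟨n, hn⟩ := hN y
  induction n generalizing y with
  | zero =>
    exact absurd (hn 1 (by simp)) (hy 1 p.2.one_notMem)
  | succ n ih =>
    by_cases h : ∃ a ∈ I, ∀ r ∉ p.asIdeal, r • a • y ≠ 0
    · obtain ⟨a, ha, hay⟩ := h
      refine ih (a • y) hay fun b hb ↦ ?_
      rw [smul_smul]
      exact hn _ (pow_succ I n ▸ Ideal.mul_mem_mul hb ha)
    · push Not at h
      obtain ⟨s, hs⟩ := (isNoetherianRing_iff_ideal_fg R).mp inferInstance I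
      choose! r hr hry using h
      let t := ∏ a ∈ s, r a
      have ht : t ∉ p.asIdeal := fun ht ↦ by
        obtain ⟨a, ha, har⟩ := (p.2.prod_mem_iff).mp ht
        exact hr a (hs ▸ Ideal.subset_span ha) har
      have hty : t • y ∈ annihilatedBy (I : Set R) N := by
        rw [← hs, annihilatedBy_span]
        intro a ha
        have haI : a ∈ I := hs ▸ Ideal.subset_span ha
        obtain ⟨c, hc⟩ := Finset.dvd_prod_of_mem r ha
        change a • (∏ a ∈ s, r a) • y = 0
        rw [hc, smul_comm, mul_comm, mul_smul, hry a haI, smul_zero]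
      refine Module.mem_support_iff'.mpr ⟨⟨t • y, hty⟩, fun r hr h ↦ ?_⟩
      have h' : r • t • y = 0 := congrArg Subtype.val h
      rw [smul_smul] at h'
      exact hy _ (fun hrt ↦ (p.2.mem_or_mem hrt).elim hr ht) h'

/-- The minimal primes of the support are those of the annihilator of the finitely generated
submodule of elements annihilated by `I`. -/
lemma finite_setOf_isMinSupport [IsNoetherianRing R] (hN : IsPowTorsion I N)
    (hfin : Module.Finite R (annihilatedBy (I : Set R) N)) :
    {p | IsMinSupport (R := R) p N}.Finite := by
  let J := Module.annihilator R (annihilatedBy (I : Set R) N)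
  have hJ : Module.support R N = PrimeSpectrum.zeroLocus J := by
    rw [← hN.support_annihilatedBy, Module.support_eq_zeroLocus]
  refine Set.Finite.of_finite_image (f := PrimeSpectrum.asIdeal)
    ((J.finite_minimalPrimes_of_isNoetherianRing R).subset ?_)
    (fun p _ q _ h ↦ PrimeSpectrum.ext h)
  rintro _ ⟨p, hp, rfl⟩
  have hp' : Minimal (· ∈ Module.support R N) p := hp
  rw [hJ] at hp'
  exact ⟨⟨p.2, hp'.1⟩, fun q hq hqp ↦ hp'.2 (y := ⟨q, hq.1⟩) hq.2 hqp⟩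

/-- At a minimal prime of the support, every element is annihilated by powers of the elements of
`p`, up to a factor outside `p`. -/
lemma IsMinSupport.exists_pow_smul_eq_zero {p : PrimeSpectrum R} (hp : IsMinSupport p N) {x : R}
    (hx : x ∈ p.asIdeal) (y : N) : ∃ s ∉ p.asIdeal, ∃ n : ℕ, s • x ^ n • y = 0 := by
  by_contra! h
  let a := (Submodule.span R {y}).annihilator
  let S := p.asIdeal.primeCompl ⊔ Submonoid.powers x
  have hdisj : Disjoint (a : Set R) S := by
    rw [Set.disjoint_left]
    rintro b hb hbS
    obtain ⟨s, hs, _, ⟨n, rfl⟩, rfl⟩ := Submonoid.mem_sup.mp hbS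
    apply h s hs n
    rw [smul_smul]
    exact (Submodule.mem_annihilator_span_singleton _ _).mp hb
  obtain ⟨q, hq, haq, hqS⟩ := Ideal.exists_le_prime_disjoint a S hdisj
  have hqp : q ≤ p.asIdeal := fun b hb ↦ by
    by_contra hbp
    exact Set.disjoint_left.mp hqS hb (Submonoid.mem_sup_left hbp)
  have hqN : (⟨q, hq⟩ : PrimeSpectrum R) ∈ Module.support R N :=
    Module.mem_support_iff_exists_annihilator.mpr ⟨y, haq⟩
  have hpq := hp.2 hqN hqp
  exact Set.disjoint_left.mp hqS (hpq hx) (Submonoid.mem_sup_right ⟨1, pow_one x⟩)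

/-- The localization of `N` at a minimal prime of its support is Artinian. -/
lemma IsMinSupport.isArtinian_localizedModule [IsNoetherianRing R] (hN : IsPowTorsion I N)
    (hfin : Module.Finite R (annihilatedBy (I : Set R) N)) {p : PrimeSpectrum R}
    (hp : IsMinSupport p N) :
    IsArtinian (Localization.AtPrime p.asIdeal) (LocalizedModule p.asIdeal.primeCompl N) := by
  classical
  let S := p.asIdeal.primeCompl
  let Rp := Localization.AtPrime p.asIdeal
  let m := IsLocalRing.maximalIdeal Rp
  obtain ⟨s, hs⟩ := (isNoetherianRing_iff_ideal_fg R).mp inferInstance p.asIdeal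
  have hsp {x : R} (hx : x ∈ s) : x ∈ p.asIdeal := hs ▸ Ideal.subset_span hx
  have hm : m = Ideal.span ((s.image (algebraMap R Rp) : Finset Rp) : Set Rp) := by
    rw [Finset.coe_image, ← Ideal.map_span]
    exact (Localization.AtPrime.map_eq_maximalIdeal (I := p.asIdeal)).symm.trans (congrArg _ hs.symm)
  have hsmul (x : R) (z : LocalizedModule S N) : algebraMap R Rp x • z = x • z :=
    algebraMap_smul Rp x z
  refine isArtinian_of_isArtinian_annihilatedBy (s.image (algebraMap R Rp)) ?_ ?_
  · intro a ha z
    obtain ⟨x, hx, rfl⟩ := Finset.mem_image.mp ha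
    induction z using LocalizedModule.induction_on with | _ y t
    obtain ⟨r, hr, n, hn⟩ := hp.exists_pow_smul_eq_zero (hsp hx) y
    refine ⟨n, ?_⟩
    rw [← map_pow, hsmul, LocalizedModule.smul'_mk]
    rw [← LocalizedModule.zero_mk t, LocalizedModule.mk_eq]
    refine ⟨⟨r, hr⟩, ?_⟩
    change r • (t : R) • x ^ n • y = r • (t : R) • (0 : N)
    rw [smul_comm, hn, smul_zero, smul_zero]
  · rw [← annihilatedBy_span, ← hm]
    -- Up to units, an element annihilated by `m` comes from an element annihilated by `p ⊇ I`.
    obtain ⟨T, hT⟩ := Module.Finite.fg_top (R := R) (M := annihilatedBy (I : Set R) N)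
    let g : annihilatedBy (I : Set R) N →ₗ[R] LocalizedModule S N :=
      LocalizedModule.mkLinearMap S N ∘ₗ (annihilatedBy (I : Set R) N).subtype
    have hle : annihilatedBy (m : Set Rp) (LocalizedModule S N) ≤
        Submodule.span Rp ((T.image g : Finset _) : Set (LocalizedModule S N)) := by
      intro z hz
      induction z using LocalizedModule.induction_on with | _ y t
      have h (x : R) (hx : x ∈ s) : ∃ r ∉ p.asIdeal, r • x • y = 0 := by
        have h1 := hz (algebraMap R Rp x) (by
          rw [hm]; exact Ideal.subset_span (Finset.mem_image_of_mem _ hx))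
        rw [hsmul, LocalizedModule.smul'_mk, ← LocalizedModule.zero_mk t,
          LocalizedModule.mk_eq] at h1
        obtain ⟨v, hv⟩ := h1
        refine ⟨v * t, S.mul_mem v.2 t.2, ?_⟩
        simpa [Submonoid.smul_def, mul_smul] using hv
      choose! r hr hry using h
      let b := ∏ x ∈ s, r x
      have hb : b ∈ S := S.prod_mem hr
      have hby : b • y ∈ annihilatedBy (I : Set R) N := by
        have h1 : b • y ∈ annihilatedBy (p.asIdeal : Set R) N := by
          rw [← hs, annihilatedBy_span]
          intro x hx
          obtain ⟨c, hc⟩ := Finset.dvd_prod_of_mem r hx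
          change x • (∏ x ∈ s, r x) • y = 0
          rw [hc, smul_comm, mul_comm, mul_smul, hry x hx, smul_zero]
        exact fun a ha ↦ h1 a (hN.support_subset hp.1 ha)
      have h2 : g ⟨b • y, hby⟩ ∈
          Submodule.span Rp ((T.image g : Finset _) : Set (LocalizedModule S N)) := by
        have h3 : g ⟨b • y, hby⟩ ∈ Submodule.span R (g '' T) := by
          rw [← Submodule.map_span, hT]
          exact ⟨_, Submodule.mem_top, rfl⟩
        rw [Finset.coe_image]
        exact Submodule.span_subset_span R Rp _ h3
      have h4 : LocalizedModule.mk y t =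
          (Localization.mk 1 (t * ⟨b, hb⟩) : Rp) • g ⟨b • y, hby⟩ := by
        change _ = Localization.mk 1 (t * ⟨b, hb⟩) • LocalizedModule.mk (b • y) 1
        rw [LocalizedModule.mk_smul_mk, LocalizedModule.mk_eq]
        exact ⟨1, by simp [Submonoid.smul_def, mul_smul]⟩
      rw [h4]
      exact Submodule.smul_mem _ _ h2
    have hfg : (annihilatedBy (m : Set Rp) (LocalizedModule S N)).FG :=
      have : IsNoetherian Rp
          (Submodule.span Rp ((T.image g : Finset _) : Set (LocalizedModule S N))) :=
        isNoetherian_of_fg_of_noetherian _ ⟨_, rfl⟩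
      isNoetherian_submodule.mp this _ hle
    have : Module.Finite Rp (annihilatedBy (m : Set Rp) (LocalizedModule S N)) :=
      Module.Finite.iff_fg.mpr hfg
    exact isArtinian_of_finite_of_isMaximal m fun a ha y ↦ Subtype.ext (y.2 a ha)

/-- The descending chain `x^n N` is stationary, for some `n`, at all the finitely many minimal
primes of the support of `N`. -/
lemma exists_pow_smul_stable [IsNoetherianRing R] (hN : IsPowTorsion I N)
    (hfin : Module.Finite R (annihilatedBy (I : Set R) N)) (x : R) :
    ∃ n : ℕ, ∀ p : PrimeSpectrum R, IsMinSupport p N → ∀ y : N,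
      ∃ s ∉ p.asIdeal, ∃ z : N, s • x ^ n • y = x ^ (n + 1) • z := by
  have hloc (p : PrimeSpectrum R) (hp : IsMinSupport p N) : ∃ n : ℕ, ∀ y : N,
      ∃ s ∉ p.asIdeal, ∃ z : N, s • x ^ n • y = x ^ (n + 1) • z := by
    let S := p.asIdeal.primeCompl
    let Rp := Localization.AtPrime p.asIdeal
    have := hp.isArtinian_localizedModule hN hfin
    obtain ⟨n, hn⟩ := IsArtinian.range_smul_pow_stabilizes (LocalizedModule S N)
      (algebraMap R Rp x)
    refine ⟨n, fun y ↦ ?_⟩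
    obtain ⟨z, hz⟩ : (algebraMap R Rp x) ^ n • LocalizedModule.mk y (1 : S) ∈
        LinearMap.range (algebraMap R Rp x ^ (n + 1) •
          (LinearMap.id : LocalizedModule S N →ₗ[Rp] _)) := by
      rw [← hn (n + 1) (Nat.le_succ n)]
      exact ⟨_, rfl⟩
    induction z using LocalizedModule.induction_on with | _ z t
    rw [LinearMap.smul_apply, LinearMap.id_apply, ← map_pow, ← map_pow, algebraMap_smul,
      algebraMap_smul, LocalizedModule.smul'_mk, LocalizedModule.smul'_mk,
      LocalizedModule.mk_eq] at hz
    obtain ⟨v, hv⟩ := hz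
    refine ⟨v * t, S.mul_mem v.2 t.2, (v : R) • z, ?_⟩
    rw [smul_comm (x ^ (n + 1))]
    simpa [Submonoid.smul_def, mul_smul] using hv.symm
  choose! n hn using hloc
  have hs := finite_setOf_isMinSupport hN hfin
  refine ⟨hs.toFinset.sup n, fun p hp y ↦ ?_⟩
  obtain ⟨s, hs', z, hz⟩ := hn p hp y
  have hle : n p ≤ hs.toFinset.sup n := Finset.le_sup (hs.mem_toFinset.mpr hp)
  refine ⟨s, hs', z, ?_⟩
  obtain ⟨d, hd⟩ := Nat.exists_eq_add_of_le' hle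
  rw [hd, pow_add, mul_smul, smul_comm s, hz, smul_smul, ← pow_add, add_assoc]

/-- Removing the minimal primes from the support lowers its dimension. -/
lemma supportDim_lt_of_not_isMinSupport {k : ℕ} {Q : Type u} [AddCommGroup Q] [Module R Q]
    (hQN : Module.support R Q ⊆ Module.support R N)
    (hmin : ∀ p ∈ Module.support R Q, ¬ IsMinSupport p N)
    (hN : Module.supportDim R N < ((k + 1 : ℕ) : WithBot ℕ∞)) :
    Module.supportDim R Q < (k : WithBot ℕ∞) := by
  by_contra! h
  obtain ⟨l, hl⟩ := Order.le_krullDim_iff.mp h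
  have h0 := hmin l.head l.head.2
  have h1 : l.head.1 ∈ Module.support R N := hQN l.head.2
  obtain ⟨q, hq, hql⟩ : ∃ q ∈ Module.support R N, q < l.head.1 := by
    by_contra! hc
    exact h0 ⟨h1, fun q hq hqp ↦ by
      by_contra hlt
      exact hc q hq (lt_of_le_not_ge hqp hlt)⟩
  let l' : LTSeries (Module.support R N) := l.map (Set.inclusion hQN) fun a b hab ↦ hab
  let l'' : LTSeries (Module.support R N) := l'.cons ⟨q, hq⟩ hql
  refine hN.not_ge (Order.le_krullDim_iff.mpr ⟨l'', ?_⟩)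
  exact (RelSeries.cons_length _ _ _).trans (congrArg (· + 1) hl)

end Support

/-! ### Cofiniteness in small dimension -/

section Cofinite

variable {R : Type u} [CommRing R] [IsNoetherianRing R] {I : Ideal R}

/-- The kernel of an endomorphism inherits the finiteness of `Ext^j(R/I, -)` for `j = 0` and for
`j = 0, 1`: its `Ext^1` is controlled by `Hom(R/I, -)` of the image, which is a submodule. -/
lemma ExtFin.ker_of_lt {k : ℕ} (hk : k ≤ 2) {N : Type u} [AddCommGroup N] [Module R N]
    (hN : ∀ j < k, ExtFin I j N) (φ : N →ₗ[R] N) : ∀ j < k, ExtFin I j (LinearMap.ker φ) := by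
  intro j hj
  have h0 : ExtFin I 0 N := hN 0 (by omega)
  obtain rfl | rfl : j = 0 ∨ j = 1 := by omega
  · exact h0.zero_of_injective (LinearMap.ker φ).injective_subtype
  · have hex := LinearMap.exact_subtype_ker_rangeRestrict φ
    exact ExtFin.left (LinearMap.ker φ).injective_subtype φ.surjective_rangeRestrict hex
      (h0.zero_of_injective (LinearMap.range φ).injective_subtype) (hN 1 hj)

lemma ExtFin.range_of_ker {k : ℕ} {N : Type u} [AddCommGroup N] [Module R N]
    (hN : ∀ j < k, ExtFin I j N) (φ : N →ₗ[R] N) (hK : ∀ j, ExtFin I j (LinearMap.ker φ)) :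
    ∀ j < k, ExtFin I j (LinearMap.range φ) := by
  intro j hj
  have hex := LinearMap.exact_subtype_ker_rangeRestrict φ
  exact ExtFin.right (LinearMap.ker φ).injective_subtype φ.surjective_rangeRestrict hex
    (hN j hj) (hK (j + 1))

/-- A torsion module of dimension `< k ≤ 2` with `Ext^j(R/I, -)` finitely generated for `j < k` has
all `Ext^j(R/I, -)` finitely generated. The induction on `k` is combined with an induction on the
number of generators of `I` that are not nilpotent on `N`: the latter treats the kernels of powers
of a generator `x`, and where the chain `x^n N` becomes stationary at the minimal primes of the
support, the cokernel of `x` has smaller dimension. -/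
theorem extFin_of_supportDim_lt {k : ℕ} (hk : k ≤ 2) {N : Type u} [AddCommGroup N] [Module R N]
    (htors : IsPowTorsion I N) (hdim : Module.supportDim R N < (k : WithBot ℕ∞))
    (hN : ∀ j < k, ExtFin I j N) (j : ℕ) : ExtFin I j N := by
  classical
  induction k generalizing N j with
  | zero =>
    have : Subsingleton N := by
      by_contra h
      rw [not_subsingleton_iff_nontrivial] at h
      have : Nonempty (Module.support R N) :=
        (Module.nonempty_support_of_nontrivial (R := R) (M := N)).to_subtype
      exact hdim.not_ge Order.krullDim_nonneg
    exact ExtFin.of_finite j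
  | succ k ihk =>
    obtain ⟨s, hs⟩ := (isNoetherianRing_iff_ideal_fg R).mp inferInstance I
    suffices H : ∀ (s' : Finset R) (N : Type u) [AddCommGroup N] [Module R N],
        IsPowTorsion I N → Module.supportDim R N < ((k + 1 : ℕ) : WithBot ℕ∞) →
        (∀ j < k + 1, ExtFin I j N) →
        (∀ x ∈ s, x ∈ s' ∨ ∃ n : ℕ, ∀ y : N, x ^ n • y = 0) → ∀ j, ExtFin I j N from
      H s N htors hdim hN (fun x hx ↦ Or.inl hx) j
    intro s'
    induction s' using Finset.induction_on with
    | empty =>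
      intro N _ _ _ _ hN hnil j
      have hsoc := extFin_zero_iff.mp (hN 0 k.succ_pos)
      rw [← hs, annihilatedBy_span] at hsoc
      have := finite_of_finite_annihilatedBy s
        (fun x hx ↦ (hnil x hx).resolve_left (Finset.notMem_empty x)) hsoc
      exact ExtFin.of_finite j
    | insert x s' _ ih =>
      intro N _ _ htors hdim hN hnil
      by_cases hxs : x ∈ s
      swap
      · refine ih N htors hdim hN fun z hz ↦ (hnil z hz).imp_left fun h ↦ ?_
        exact (Finset.mem_insert.mp h).resolve_left fun h ↦ hxs (h ▸ hz)
      have hxI : x ∈ I := hs ▸ Ideal.subset_span hxs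
      obtain ⟨n, hn⟩ := exists_pow_smul_stable htors (extFin_zero_iff.mp (hN 0 k.succ_pos)) x
      -- The induction hypothesis applies to submodules on which `x` is nilpotent.
      have hsub (N' : Type u) [AddCommGroup N'] [Module R N'] (f : N' →ₗ[R] N)
          (hf : Function.Injective f) (hN' : ∀ j < k + 1, ExtFin I j N')
          (hx : ∃ n : ℕ, ∀ y : N', x ^ n • y = 0) : ∀ j, ExtFin I j N' := by
        refine ih N' (htors.of_injective hf)
          ((Module.supportDim_le_of_injective f hf).trans_lt hdim) hN' fun z hz ↦ ?_
        obtain h | ⟨m, hm⟩ := hnil z hz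
        · obtain rfl | h := Finset.mem_insert.mp h
          · exact Or.inr hx
          · exact Or.inl h
        · exact Or.inr ⟨m, fun y ↦ hf (by rw [map_smul, hm, map_zero])⟩
      let φ := LinearMap.lsmul R N (x ^ n)
      have hL := hsub _ _ (LinearMap.ker φ).injective_subtype (ExtFin.ker_of_lt hk hN φ)
        ⟨n, fun y ↦ Subtype.ext y.2⟩
      let P := LinearMap.range φ
      have hP := ExtFin.range_of_ker hN φ hL
      let ψ := LinearMap.lsmul R P x
      have hK := hsub _ (P.subtype ∘ₗ (LinearMap.ker ψ).subtype)
        (P.injective_subtype.comp (LinearMap.ker ψ).injective_subtype)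
        (ExtFin.ker_of_lt hk hP ψ) ⟨1, fun y ↦ Subtype.ext (by
          rw [pow_one]; exact y.2)⟩
      have hxP := ExtFin.range_of_ker hP ψ hK
      let Q := P ⧸ LinearMap.range ψ
      have hQex := LinearMap.exact_subtype_mkQ (LinearMap.range ψ)
      have hQ (j : ℕ) (hj : j < k) : ExtFin I j Q :=
        ExtFin.right (LinearMap.range ψ).injective_subtype (LinearMap.range ψ).mkQ_surjective
          hQex (hP j (by omega)) (hxP (j + 1) (by omega))
      have hQsupp : Module.support R Q ⊆ Module.support R N :=
        (Module.support_subset_of_surjective _ (LinearMap.range ψ).mkQ_surjective).trans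
          (Module.support_subset_of_injective _ P.injective_subtype)
      have hQdim : Module.supportDim R Q < (k : WithBot ℕ∞) := by
        refine supportDim_lt_of_not_isMinSupport hQsupp (fun p hpQ hp ↦ ?_) hdim
        refine Module.notMem_support_iff'.mpr ?_ hpQ
        intro q
        obtain ⟨⟨_, y, rfl⟩, rfl⟩ := (LinearMap.range ψ).mkQ_surjective q
        obtain ⟨r, hr, z, hz⟩ := hn p hp y
        refine ⟨r, hr, ?_⟩
        rw [← map_smul, Submodule.mkQ_apply, Submodule.Quotient.mk_eq_zero]
        refine ⟨⟨φ z, z, rfl⟩, Subtype.ext ?_⟩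
        change x • x ^ n • z = r • x ^ n • y
        rw [hz, smul_smul, pow_succ']
      have hQall (j : ℕ) : ExtFin I j Q :=
        ihk (by omega) ((htors.submodule P).quotient _) hQdim hQ j
      have hPall := ExtFin.of_ker_of_coker hxI hK hQall
      have hex := LinearMap.exact_subtype_ker_rangeRestrict φ
      exact fun j ↦ ExtFin.middle (LinearMap.ker φ).injective_subtype φ.surjective_rangeRestrict
        hex (hL j) (hPall j)

/-- A torsion `FD_{≤ n}` module with `n ≤ 1` and `Ext^j(R/I, -)` finitely generated for `j ≤ n` has
all `Ext^j(R/I, -)` finitely generated. -/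
theorem IsFDLE.extFin {n : ℕ} (hn : n ≤ 1) {N : Type u} [AddCommGroup N] [Module R N]
    (hFD : IsFDLE R n N) (htors : IsPowTorsion I N) (hN : ∀ j ≤ n, ExtFin I j N) (j : ℕ) :
    ExtFin I j N := by
  obtain ⟨F, hF, hdim⟩ := hFD
  have : Module.Finite R F := Module.Finite.iff_fg.mpr hF
  have hex : Function.Exact F.subtype F.mkQ := LinearMap.exact_subtype_mkQ _
  have hD : ∀ j < n + 1, ExtFin I j (N ⧸ F) := fun j hj ↦
    ExtFin.right F.injective_subtype F.mkQ_surjective hex (hN j (by omega)) (ExtFin.of_finite _)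
  have hlt : Module.supportDim R (N ⧸ F) < ((n + 1 : ℕ) : WithBot ℕ∞) :=
    lt_of_le_of_lt hdim (by exact_mod_cast Nat.lt_succ_self n)
  exact ExtFin.middle F.injective_subtype F.mkQ_surjective hex (ExtFin.of_finite _)
    (extFin_of_supportDim_lt (by omega) (htors.quotient F) hlt hD j)

/-- The support of an Artinian module consists of maximal ideals. -/
lemma supportDim_le_zero_of_isArtinian {R : Type u} [CommRing R] (N : Type u) [AddCommGroup N]
    [Module R N] [IsArtinian R N] : Module.supportDim R N ≤ 0 := by
  refine Order.krullDim_nonpos_iff_forall_isMax.mpr ?_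
  rintro ⟨p, hp⟩ ⟨q, hq⟩ hpq
  obtain ⟨y, hy⟩ := Module.mem_support_iff_exists_annihilator.mp hp
  have h1 : IsArtinian R (R ⧸ p.asIdeal) := by
    have h2 : IsArtinian R (R ⧸ LinearMap.ker (LinearMap.toSpanSingleton R N y)) :=
      isArtinian_of_linearEquiv (LinearMap.toSpanSingleton R N y).quotKerEquivRange.symm
    refine isArtinian_of_surjective _
      (Submodule.factor (p := LinearMap.ker (LinearMap.toSpanSingleton R N y)) (p' := p.asIdeal)
        fun a ha ↦ hy ((Submodule.mem_annihilator_span_singleton _ _).mpr ha))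
      (Submodule.factor_surjective _)
  have h2 : IsArtinianRing (R ⧸ p.asIdeal) := isArtinian_of_tower R h1
  have hmax : p.asIdeal.IsMaximal := Ideal.Quotient.maximal_of_isField _
    (IsArtinianRing.isField_of_isDomain _)
  exact (PrimeSpectrum.ext (hmax.eq_of_le q.2.ne_top hpq)).ge

lemma IsMinimax.isFDLE_zero {R : Type u} [CommRing R] {N : Type u} [AddCommGroup N] [Module R N]
    (h : IsMinimax R N) : IsFDLE R 0 N :=
  h.imp fun F ⟨hF, _⟩ ↦ ⟨hF, supportDim_le_zero_of_isArtinian (N ⧸ F)⟩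

/-- An associated prime of a torsion module is associated to the submodule of elements annihilated
by `I`. -/
lemma finite_associatedPrimes_of_isPowTorsion {L : Type u} [AddCommGroup L] [Module R L]
    (htors : IsPowTorsion I L) (hL : ExtFin I 0 L) : (associatedPrimes R L).Finite := by
  have : Module.Finite R (annihilatedBy (I : Set R) L) := extFin_zero_iff.mp hL
  refine (associatedPrimes.finite R (annihilatedBy (I : Set R) L)).subset ?_
  intro p hp
  obtain ⟨hprime, y, rfl⟩ := isAssociatedPrime_iff.mp hp
  obtain ⟨n, hn⟩ := htors y
  have hy : y ∈ annihilatedBy (I : Set R) L := fun a ha ↦ by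
    have h : a ^ n ∈ (⊥ : Submodule R L).colon {y} :=
      Submodule.mem_colon_singleton.mpr (hn _ (Ideal.pow_mem_pow ha n))
    exact Submodule.mem_colon_singleton.mp (hprime.mem_of_pow_mem n h)
  refine isAssociatedPrime_iff.mpr ⟨hprime, ⟨y, hy⟩, ?_⟩
  ext a
  rw [Submodule.mem_colon_singleton, Submodule.mem_colon_singleton, Submodule.mem_bot,
    Submodule.mem_bot, ← Subtype.coe_inj]
  rfl

end Cofinite

/-! ### Local cohomology that is `FD_{≤ 1}` below degree `t` -/

theorem theorem3p4 {R : Type u} [CommRing R] [IsNoetherianRing R] (I : Ideal R)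
    (M : Type u) [AddCommGroup M] [Module R M] [Module.Finite R M]
    (t : ℕ) (ht : 1 ≤ t) (hFD : ∀ i < t, IsFDLE R 1 (LocalCoh I i M)) :
    (∀ i < t, IsIdealCofinite I (LocalCoh I i M)) ∧
    (∀ N : Submodule R (LocalCoh I t M), (IsFDLE R 0 N ∨ IsMinimax R N) →
      Module.Finite R ((R ⧸ I) →ₗ[R] (LocalCoh I t M ⧸ N)) ∧
      Module.Finite R (ExtQuot I (LocalCoh I t M ⧸ N) 1) ∧
      (associatedPrimes R (LocalCoh I t M ⧸ N)).Finite) := by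
  have htors (i : ℕ) : IsPowTorsion I (LocalCoh I i M) :=
    (isPowTorsion_extLim i).of_surjective (f := (localCohEquiv I i M).toLinearMap)
      (localCohEquiv I i M).surjective
  have hstep (i : ℕ) (hi : ∀ l < i, ∀ j, ExtFin I j (LocalCoh I l M)) :
      ExtFin I 0 (LocalCoh I i M) ∧ ExtFin I 1 (LocalCoh I i M) :=
    (extFin_extLim_of_forall_lt i (fun j ↦ ExtFin.of_finite j)
      fun l hl j ↦ (hi l hl j).of_equiv (localCohEquiv I l M).symm).imp
      (·.of_equiv (localCohEquiv I i M)) (·.of_equiv (localCohEquiv I i M))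
  have hcof (i : ℕ) : i < t → ∀ j, ExtFin I j (LocalCoh I i M) := by
    induction i using Nat.strong_induction_on with
    | _ i ih =>
      intro hi
      obtain ⟨h0, h1⟩ := hstep i fun l hl ↦ ih l hl (hl.trans hi)
      refine IsFDLE.extFin le_rfl (by exact_mod_cast hFD i hi) (htors i) fun j hj ↦ ?_
      obtain rfl | rfl : j = 0 ∨ j = 1 := by omega
      exacts [h0, h1]
  refine ⟨fun i hi ↦ ⟨(htors i).support_subset, hcof i hi⟩, fun N hN ↦ ?_⟩
  obtain ⟨h0, h1⟩ := hstep t hcof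
  have hN0 : ExtFin I 0 N := h0.zero_of_injective N.injective_subtype
  have hNall := IsFDLE.extFin (n := 0) zero_le_one
    (by exact_mod_cast hN.elim id IsMinimax.isFDLE_zero) ((htors t).submodule N)
    (fun j hj ↦ by rwa [Nat.le_zero.mp hj])
  have hex : Function.Exact N.subtype N.mkQ := LinearMap.exact_subtype_mkQ _
  have hq0 : ExtFin I 0 (LocalCoh I t M ⧸ N) :=
    ExtFin.right N.injective_subtype N.mkQ_surjective hex h0 (hNall 1)
  exact ⟨finite_hom_iff.mpr hq0,
    ExtFin.right N.injective_subtype N.mkQ_surjective hex h1 (hNall 2),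
    finite_associatedPrimes_of_isPowTorsion ((htors t).quotient N) hq0⟩
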